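/- Let $\lambda(n)>0$ ($n\ge 0$), $\mu(0)=0$, $\mu(n)>0$ ($n\ge1$) be the rates of a birth and death chain on $\mathbb N=\{0,1,\dots\}$, put $\pi(n)=\prod_{k=1}^n\lambda(k-1)/\mu(k)$, and let $\hat\lambda(n)=\mu(n+1)$, $\hat\mu(n)=\lambda(n)$, $\hat\pi(n)=\prod_{k=1}^n\hat\lambda(k-1)/\hat\mu(k)$ be the data of the Siegmund dual chain. Let $Q_n$ be the polynomials with $Q_0=1$ and $$-xQ_n=\mu(n)Q_{n-1}-(\lambda(n)+\mu(n))Q_n+\lambda(n)Q_{n+1}\qquad(n\ge 0,\ Q_{-1}=0),$$ and $\hat Q_n$ the polynomials given by the same recursion with $(\hat\lambda,\hat\mu)$ in place of $(\lambda,\mu)$. Let $\mathfrak w$ and $\hat{\mathfrak w}$ be the corresponding spectral measures, i.e. measures on $[0,\infty)$ with finite moments and $\int Q_iQ_j\,d\mathfrak w=\delta_{ij}/\pi(j)$, $\int \hat Q_i\hat Q_j\,d\hat{\mathfrak w}=\delta_{ij}/\hat\pi(j)$. Assume that the support $\mathfrak I$ of $\mathfrak w$ is compact, and let $I^-$, $I^+$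 be its lower and upper endpoints. A level is a pair $(n_1,n_2)$ of the form $(n,n+1)$ or $(n,n)$, and levels are ordered componentwise: $\dots<(n,n)<(n,n+1)<(n+1,n+1)<\dots$. For levels $(n_1,n_2)$, $(m_1,m_2)$ and $i,j\in\mathbb N$ put $(\bar{\mathcal P}_i,\mathfrak m)=(\pi(i)Q_i,\mathfrak w)$ if $n_2=n_1+1$, $(\bar{\mathcal P}_i,\mathfrak m)=(\hat\pi(i)\hat Q_i,\hat{\mathfrak w})$ if $n_2=n_1$, $\tilde{\mathcal P}_j=Q_j$ if $m_2=m_1+1$, and $\tilde{\mathcal P}_j=\hat Q_j$ if $m_2=m_1$. With $\psi_t(x)=e^{-tx}$, and $\mathsf C$ a positively oriented circle whose interior contains $[0,I^+]$, let $$\mathcal K^{\psi}\big(((n_1,n_2),i),((m_1,m_2),j)\big)=\frac1{2\pi \mathrm i}\oint_{\mathsf C}\tilde{\mathcal P}_j(u)\int\bar{\mathcal P}_i(x)\frac{x^{n_2}}{u^{m_2}}\frac{\psi(x)}{(x-u)\psi(u)}\,d\mathfrak m(x)\,du+\mathbf 1\big((n_1,n_2)\ge(m_1,m_2)\big)\int\bar{\mathcal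 P}_i(x)x^{n_2-m_2}\tilde{\mathcal P}_j(x)\,d\mathfrak m(x).$$ Let $\tau,\eta>0$, $\alpha=\eta/\tau$, and assume $\mathfrak w(\{\alpha\})=0$. Then for all levels $(n_1,n_2)$, $(m_1,m_2)$ with integer entries and all $i,j\in\mathbb N$, as $N\to\infty$, $$\mathcal K^{\psi_{N\tau}}\big(((\lfloor N\eta\rfloor+n_1,\lfloor N\eta\rfloor+n_2),i),((\lfloor N\eta\rfloor+m_1,\lfloor N\eta\rfloor+m_2),j)\big)\longrightarrow\mathfrak K_\alpha\big(((n_1,n_2),i),((m_1,m_2),j)\big),$$ $$\mathfrak K_\alpha\big(((n_1,n_2),i),((m_1,m_2),j)\big)=\int_{I^-}^{I^+}\Big[-\mathbf 1(x\ge\alpha)+\mathbf 1\big((n_1,n_2)\ge(m_1,m_2)\big)\Big]\bar{\mathcal P}_i(x)\,x^{n_2-m_2}\,\tilde{\mathcal P}_j(x)\,d\mathfrak m(x),$$ where the integrand of the last integral is integrable. Moreover, for $\mathcal W=\mathfrak w$ and for $\mathcal W=\hat{\mathfrak w}$ there are orthonormal polynomials $P^*_k$, $k\ge0$, with respect to $\mathcal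 W$ with $\deg P^*_k=k$ and positive leading coefficient. Let $\mathsf K^{\mathcal W}_{r}(i,j)=\int_{r}^\infty P_i^*P_j^*\,d\mathcal W$ be the kernel of the Borodin--Olshanski discrete ensemble of $\mathcal W$ and $r$. For every $n$ the single-level kernel $(i,j)\mapsto\mathfrak K_\alpha(((n,n+1),i),((n,n+1),j))$ is conjugate to $\delta_{ij}-\mathsf K^{\mathfrak w}_\alpha(i,j)$, and $(i,j)\mapsto\mathfrak K_\alpha(((n,n),i),((n,n),j))$ is conjugate to $\delta_{ij}-\mathsf K^{\hat{\mathfrak w}}_\alpha(i,j)$, where $k$ is conjugate to $k'$ if $k(i,j)=c_i\,k'(i,j)/c_j$ for some nonvanishing $c$. Accordingly, a random subset of $\mathbb N$ is determinantal with the single-level kernel at $(n,n+1)$ (respectively $(n,n)$) if and only if its complement (its holes) is determinantal with kernel $\mathsf K^{\mathfrak w}_\alpha$ (respectively $\mathsf K^{\hat{\mathfrak w}}_\alpha$). -/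

import Mathlib

open MeasureTheory Filter Topology

noncomputable section

namespace AlternatingKernel

/-- Rates of a birth and death chain on `ℕ`, reflecting at `0`. -/
structure Rates where
  birth : ℕ → ℝ
  death : ℕ → ℝ
  birth_pos : ∀ n, 0 < birth n
  death_zero : death 0 = 0
  death_pos : ∀ n, 0 < death (n + 1)

/-- The polynomials of a chain with birth rates `b` and death rates `d`: `Q₀ = 1` and
`-x Qₙ = dₙ Qₙ₋₁ - (bₙ + dₙ) Qₙ + bₙ Qₙ₊₁` (with no `Qₙ₋₁` term for `n = 0`). -/
def chainPoly (b d : ℕ → ℝ) : ℕ → Polynomial ℝ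
  | 0 => 1
  | 1 => Polynomial.C (b 0)⁻¹ * (Polynomial.C (b 0 + d 0) - Polynomial.X)
  | n + 2 => Polynomial.C (b (n + 1))⁻¹ *
      ((Polynomial.C (b (n + 1) + d (n + 1)) - Polynomial.X) * chainPoly b d (n + 1)
        - Polynomial.C (d (n + 1)) * chainPoly b d n)

/-- The symmetrizing measure `π(n) = ∏_{k=1}^{n} b(k-1) / d(k)`. -/
def symmetrizing (b d : ℕ → ℝ) (n : ℕ) : ℝ :=
  ∏ k ∈ Finset.range n, b k / d (k + 1)

namespace Rates

variable (𝒟 : Rates)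

/-- Birth rates of the Siegmund dual chain (which is absorbed at `-1`). -/
def dualBirth (n : ℕ) : ℝ := 𝒟.death (n + 1)

/-- Death rates of the Siegmund dual chain. -/
def dualDeath (n : ℕ) : ℝ := 𝒟.birth n

def Q (n : ℕ) : Polynomial ℝ := chainPoly 𝒟.birth 𝒟.death n

def symm (n : ℕ) : ℝ := symmetrizing 𝒟.birth 𝒟.death n

def dualQ (n : ℕ) : Polynomial ℝ := chainPoly 𝒟.dualBirth 𝒟.dualDeath n

def dualSymm (n : ℕ) : ℝ := symmetrizing 𝒟.dualBirth 𝒟.dualDeath n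

end Rates

/-- `w` is a measure on `[0, ∞)` with finite moments for which the polynomials `q` are orthogonal,
with squared norms `1 / p`. -/
structure IsSpectralMeasure (q : ℕ → Polynomial ℝ) (p : ℕ → ℝ) (w : Measure ℝ) : Prop where
  nonneg : w (Set.Iio 0) = 0
  moments : ∀ k : ℕ, Integrable (fun x : ℝ => x ^ k) w
  orthogonal : ∀ i j : ℕ,
    ∫ x, (q i).eval x * (q j).eval x ∂w = if i = j then 1 / p j else 0

/-- Levels of a symplectic Gelfand-Tsetlin pattern: `odd n` is the level `(n, n+1)` and `even n`
is the level `(n, n)`. Integers are allowed, so that shifts of levels may be negative. -/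
inductive Level where
  | odd (n : ℤ) : Level
  | even (n : ℤ) : Level

namespace Level

def fst : Level → ℤ
  | odd n => n
  | even n => n

def snd : Level → ℤ
  | odd n => n + 1
  | even n => n

/-- Adding `k` to both entries of a level. -/
def shift (k : ℤ) : Level → Level
  | odd n => odd (k + n)
  | even n => even (k + n)

/-- `⋯ < (n, n) < (n, n+1) < (n+1, n+1) < ⋯`. -/
instance : LE Level := ⟨fun m n => m.fst ≤ n.fst ∧ m.snd ≤ n.snd⟩

end Level

/-- The polynomial `P̄ᵢ` at a level. -/
def barP (𝒟 : Rates) : Level → ℕ → Polynomial ℝ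
  | .odd _, i => Polynomial.C (𝒟.symm i) * 𝒟.Q i
  | .even _, i => Polynomial.C (𝒟.dualSymm i) * 𝒟.dualQ i

/-- The polynomial `P̃ⱼ` at a level. -/
def tildeP (𝒟 : Rates) : Level → ℕ → Polynomial ℝ
  | .odd _, j => 𝒟.Q j
  | .even _, j => 𝒟.dualQ j

/-- The spectral measure at a level: `w` at `(n, n+1)`, and the dual one `w'` at `(n, n)`. -/
def levelMeasure (w w' : Measure ℝ) : Level → Measure ℝ
  | .odd _ => w
  | .even _ => w'

open Classical in
/-- The correlation kernel `𝒦^ψ((n, i), (m, j))`, the contour being the positively oriented circle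
with centre `c` and radius `R`. -/
def corrKernel (𝒟 : Rates) (w w' : Measure ℝ) (c : ℂ) (R : ℝ) (ψ : ℂ → ℂ)
    (n : Level) (i : ℕ) (m : Level) (j : ℕ) : ℂ :=
  1 / (2 * Real.pi * Complex.I) *
    (∮ u in C(c, R), Polynomial.aeval u (tildeP 𝒟 m j) *
      ∫ x : ℝ, (((barP 𝒟 n i).eval x : ℝ) : ℂ) *
        ((x : ℂ) ^ n.snd / u ^ m.snd * (ψ x / (((x : ℂ) - u) * ψ u)))
        ∂(levelMeasure w w' n))
  + if m ≤ n then
      ((∫ x : ℝ, (barP 𝒟 n i).eval x * (x ^ (n.snd - m.snd) * (tildeP 𝒟 m j).eval x)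
        ∂(levelMeasure w w' n) : ℝ) : ℂ)
    else 0

/-- `ψ_t(z) = e^{-tz}`. -/
def psi (t : ℝ) (z : ℂ) : ℂ := Complex.exp (-(t * z))

/-- Lower endpoint of the support of `w`. -/
def lowerEnd (w : Measure ℝ) : ℝ := sInf w.support

/-- Upper endpoint of the support of `w`. -/
def upperEnd (w : Measure ℝ) : ℝ := sSup w.support

open Classical in
/-- The integrand of the limiting kernel. -/
def limitIntegrand (𝒟 : Rates) (α : ℝ) (n : Level) (i : ℕ) (m : Level) (j : ℕ) (x : ℝ) : ℝ :=
  (-(if α ≤ x then 1 else 0) + (if m ≤ n then 1 else 0)) *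
    (barP 𝒟 n i).eval x * x ^ (n.snd - m.snd) * (tildeP 𝒟 m j).eval x

/-- The limiting kernel `𝔎_α((n, i), (m, j))`. -/
def limitKernel (𝒟 : Rates) (w w' : Measure ℝ) (α : ℝ)
    (n : Level) (i : ℕ) (m : Level) (j : ℕ) : ℝ :=
  ∫ x in Set.Icc (lowerEnd w) (upperEnd w), limitIntegrand 𝒟 α n i m j x ∂(levelMeasure w w' n)

/-- `P` is the sequence of orthonormal polynomials of the weight `W`, with positive leading
coefficients. -/
structure IsOrthonormalPolys (W : Measure ℝ) (P : ℕ → Polynomial ℝ) : Prop where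
  degree : ∀ k, (P k).natDegree = k
  leading : ∀ k, 0 < (P k).leadingCoeff
  integrable : ∀ i j, Integrable (fun x => (P i).eval x * (P j).eval x) W
  orthonormal : ∀ i j, ∫ x, (P i).eval x * (P j).eval x ∂W = if i = j then 1 else 0

/-- The kernel of the discrete ensemble of the weight `W`, with orthonormal polynomials `P`, and
the point `r`. -/
def ensembleKernel (W : Measure ℝ) (P : ℕ → Polynomial ℝ) (r : ℝ) (i j : ℕ) : ℝ :=
  ∫ x in Set.Ici r, (P i).eval x * (P j).eval x ∂W

/-- The random subset of `ℕ` with law `ℙ` is determinantal with kernel `K`. -/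
def IsDeterminantal (ℙ : Measure (Set ℕ)) (K : ℕ → ℕ → ℝ) : Prop :=
  ∀ s : Finset ℕ, ℙ.real {X | (s : Set ℕ) ⊆ X} =
    (Matrix.of fun a b : s => K a b).det

/-- `k` is conjugate to the kernel `δ - K`, and a point process is determinantal with kernel `k`
exactly if its holes form a determinantal point process with kernel `K`. -/
def IsHoleKernel (k K : ℕ → ℕ → ℝ) : Prop :=
  (∃ c : ℕ → ℝ, (∀ i, c i ≠ 0) ∧
    ∀ i j, k i j = c i * ((if i = j then 1 else 0) - K i j) / c j) ∧
  ∀ ℙ : Measure (Set ℕ), IsProbabilityMeasure ℙ →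
    (IsDeterminantal ℙ k ↔ IsDeterminantal (ℙ.map fun X => Xᶜ) K)

end AlternatingKernel

end

open AlternatingKernel

/-!
The contour integral defining the correlation kernel can be evaluated exactly at `ψ = ψ_t`, so that
no steepest descent analysis is needed. For fixed `x` in the disc, the integrand
`u ^ k x ^ L ψ_t(x) / (u ^ K (x - u) ψ_t(u))` has its poles at `u = x` and `u = 0`, and the
residues add up to `-x ^ (L - K + k)` times the probability that a Poisson variable of mean `t x`
is at least `K - k` (`circleIntegral_exp_div_eq_poissonTail`, `circleIntegral_eq_tailSum`). With
`t = N τ` and `K = ⌊N η⌋ + O(1)`, the law of large numbers makes this probability converge to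
`1` for `x > η / τ` and to `0` for `x < η / τ` (`tendsto_poissonTail_one`,
`tendsto_poissonTail_zero`). The power of `x` may have a negative exponent, but the Poisson tail
absorbs the singularity at `0` uniformly in `N` (`zpow_mul_poissonTail_le`), and the limit of the
kernels follows by dominated convergence (`tendsto_integral_tailSum`).

Dominated convergence also needs the dual measure `w'` to live on the support of `w` and to have no
atom at `η / τ`. The dual polynomials are the kernel polynomials `∑_{k ≤ n} π(k) Q_k`
(`Rates.dualQ_eq_sum`), hence orthogonal for `x dw(x)`; as compactly supported measures are
determined by their moments, `w'` is a multiple of `x dw(x)` (`dual_eq_withDensity`).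

At a single level the limit is `π(i)` times the integral of `Q_i Q_j` over `x < η / τ`.
The orthonormal polynomials of the weight are unique, and equal to `(-1) ^ k √π(k) Q_k`, so that
the limit is conjugate to `δ - K`, with `K` the kernel of the discrete ensemble. Passing from `k` to
`δ - k` describes the holes by inclusion-exclusion, which is the multilinearity of the determinant
in its rows (`IsDeterminantal.map_compl`).
-/

namespace AlternatingKernel

/-! ### Determinantal processes and their holes -/

/-- The matrix on `u` whose rows are those of `k` on `s`, those of `δ - k` on `t`, and those of the
identity elsewhere. Its determinant is the probability that a determinantal process with kernel `k`
contains `s` and avoids `t`. -/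
def mixedMatrix (k : ℕ → ℕ → ℝ) (u s t : Finset ℕ) : Matrix u u ℝ :=
  Matrix.of fun a b =>
    if a.1 ∈ s then k a b
    else if a.1 ∈ t then (if a.1 = b.1 then 1 else 0) - k a b
    else if a.1 = b.1 then 1 else 0

theorem det_mixedMatrix_empty (k : ℕ → ℕ → ℝ) {u s : Finset ℕ} (hs : s ⊆ u) :
    (mixedMatrix k u s ∅).det = (Matrix.of fun a b : s => k a b).det := by
  rw [Matrix.twoBlockTriangular_det _ (fun a : u => a.1 ∈ s)]
  · have h1 : (mixedMatrix k u s ∅).toSquareBlockProp (fun a : u => ¬ a.1 ∈ s) = 1 := by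
      ext a b
      have := a.2
      simp [mixedMatrix, Matrix.toSquareBlockProp, this, Matrix.one_apply, Subtype.ext_iff,
        -SetLike.coe_eq_coe]
    rw [h1, Matrix.det_one, mul_one]
    let e : s ≃ {a : u // a.1 ∈ s} :=
      { toFun := fun a => ⟨⟨a.1, hs a.2⟩, a.2⟩
        invFun := fun a => ⟨a.1.1, a.2⟩
        left_inv := fun _ => rfl
        right_inv := fun _ => rfl }
    rw [← Matrix.det_submatrix_equiv_self e]
    congr 1
    ext a b
    simp [mixedMatrix, Matrix.toSquareBlockProp, e]
  · intro a ha b hb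
    have : a ≠ b := fun h => ha (h ▸ hb)
    simp [mixedMatrix, ha, this]

theorem det_mixedMatrix_insert (k : ℕ → ℕ → ℝ) {u s t : Finset ℕ} {a : ℕ} (ha : a ∈ u)
    (has : a ∉ s) (hat : a ∉ t) :
    (mixedMatrix k u s (insert a t)).det =
      (mixedMatrix k u s t).det - (mixedMatrix k u (insert a s) t).det := by
  have h0 : mixedMatrix k u s t = (mixedMatrix k u s t).updateRow ⟨a, ha⟩
      ((fun b : u => (if a = b.1 then 1 else 0) - k a b) + fun b : u => k a b) := by
    ext x y
    by_cases h : x = ⟨a, ha⟩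
    · subst h
      simp [mixedMatrix, has, hat, -SetLike.coe_eq_coe]
    · simp [Matrix.updateRow_ne h]
  have h1 : mixedMatrix k u s (insert a t) = (mixedMatrix k u s t).updateRow ⟨a, ha⟩
      (fun b : u => (if a = b.1 then 1 else 0) - k a b) := by
    ext x y
    by_cases h : x = ⟨a, ha⟩
    · subst h
      simp [mixedMatrix, has, -SetLike.coe_eq_coe]
    · have h' : x.1 ≠ a := fun e => h (Subtype.ext e)
      simp [Matrix.updateRow_ne h, mixedMatrix, h']
  have h2 : mixedMatrix k u (insert a s) t = (mixedMatrix k u s t).updateRow ⟨a, ha⟩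
      (fun b : u => k a b) := by
    ext x y
    by_cases h : x = ⟨a, ha⟩
    · subst h
      simp [mixedMatrix]
    · have h' : x.1 ≠ a := fun e => h (Subtype.ext e)
      simp [Matrix.updateRow_ne h, mixedMatrix, h']
  rw [h1, h2]
  conv_rhs => rw [h0]
  rw [Matrix.det_updateRow_add]
  simp

theorem measurableSet_subset_disjoint (s t : Finset ℕ) :
    MeasurableSet {X : Set ℕ | (∀ a ∈ s, a ∈ X) ∧ ∀ a ∈ t, a ∉ X} := by
  have : {X : Set ℕ | (∀ a ∈ s, a ∈ X) ∧ ∀ a ∈ t, a ∉ X} =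
      (⋂ a ∈ s, {X : Set ℕ | a ∈ X}) ∩ ⋂ a ∈ t, {X : Set ℕ | a ∉ X} := by
    ext X; simp
  rw [this]
  exact (Finset.measurableSet_biInter _ fun a _ => measurableSet_mem a).inter
    (Finset.measurableSet_biInter _ fun a _ => measurableSet_notMem a)

/-- Inclusion-exclusion, one point at a time: the row of `mixedMatrix` at a point is affine in the
condition imposed there. -/
theorem IsDeterminantal.real_subset_disjoint {ℙ : Measure (Set ℕ)} [IsProbabilityMeasure ℙ]
    {k : ℕ → ℕ → ℝ} (h : IsDeterminantal ℙ k) (u t : Finset ℕ) :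
    ∀ s : Finset ℕ, s ⊆ u → t ⊆ u → Disjoint s t →
      ℙ.real {X | (∀ a ∈ s, a ∈ X) ∧ ∀ a ∈ t, a ∉ X} = (mixedMatrix k u s t).det := by
  induction t using Finset.induction_on with
  | empty =>
    intro s hs _ _
    rw [det_mixedMatrix_empty k hs, ← h s]
    simp [Set.subset_def]
  | insert a t hat ih =>
    intro s hs ht hst
    rw [Finset.insert_subset_iff] at ht
    rw [Finset.disjoint_insert_right] at hst
    rw [det_mixedMatrix_insert k ht.1 hst.1 hat, ← ih s hs ht.2 hst.2,
      ← ih (insert a s) (Finset.insert_subset ht.1 hs) ht.2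
        (Finset.disjoint_insert_left.2 ⟨hat, hst.2⟩),
      ← measureReal_sdiff _ (measurableSet_subset_disjoint _ _)]
    · congr 1
      ext X
      simp only [Finset.mem_insert, Set.mem_ofPred_eq, Set.mem_sdiff]
      grind
    · intro X hX
      exact ⟨fun b hb => hX.1 b (Finset.mem_insert_of_mem hb), hX.2⟩

theorem measurable_compl_set : Measurable (fun X : Set ℕ => Xᶜ) :=
  measurable_set_iff.2 fun a => measurable_set_notMem a

/-- The holes of a determinantal process with kernel `k` form one with kernel `δ - k`. -/
theorem IsDeterminantal.map_compl {ℙ : Measure (Set ℕ)} [IsProbabilityMeasure ℙ]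
    {k : ℕ → ℕ → ℝ} (h : IsDeterminantal ℙ k) :
    IsDeterminantal (ℙ.map fun X => Xᶜ) (fun i j => (if i = j then 1 else 0) - k i j) := by
  intro s
  have hm : MeasurableSet {X : Set ℕ | (s : Set ℕ) ⊆ X} := by
    simpa [Set.subset_def] using measurableSet_subset_disjoint s ∅
  rw [map_measureReal_apply measurable_compl_set hm]
  have h1 := h.real_subset_disjoint s s ∅ (by simp) le_rfl (by simp)
  have h2 : mixedMatrix k s ∅ s =
      Matrix.of fun a b : s => (if a.1 = b.1 then 1 else 0) - k a b := by
    ext a b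
    simp [mixedMatrix]
  rw [← h2, ← h1]
  congr 1
  ext X
  simp [Set.subset_def]

theorem isDeterminantal_congr_of_conj {ℙ : Measure (Set ℕ)} {k k' : ℕ → ℕ → ℝ} {c : ℕ → ℝ}
    (hc : ∀ i, c i ≠ 0) (hk : ∀ i j, k i j = c i * k' i j / c j) :
    IsDeterminantal ℙ k ↔ IsDeterminantal ℙ k' := by
  have key : ∀ s : Finset ℕ, (Matrix.of fun a b : s => k a b).det =
      (Matrix.of fun a b : s => k' a b).det := by
    intro s
    have : (Matrix.of fun a b : s => k a b) =
        Matrix.of fun a b : s => (c b)⁻¹ * (Matrix.of fun a b : s => c a * k' a b) a b := by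
      ext a b
      simp [hk]
      ring
    rw [this, Matrix.det_mul_row]
    have h2 : (Matrix.of fun a b : s => c a * k' a b) =
        Matrix.of fun a b : s => c a * (Matrix.of fun a b : s => k' a b) a b := rfl
    rw [h2, Matrix.det_mul_column, ← mul_assoc, ← Finset.prod_mul_distrib]
    simp [hc]
  simp only [IsDeterminantal, key]

theorem isHoleKernel_of_conj {k K : ℕ → ℕ → ℝ} {c : ℕ → ℝ} (hc : ∀ i, c i ≠ 0)
    (hk : ∀ i j, k i j = c i * ((if i = j then 1 else 0) - K i j) / c j) : IsHoleKernel k K := by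
  refine ⟨⟨c, hc, hk⟩, fun ℙ _ => ?_⟩
  rw [isDeterminantal_congr_of_conj hc hk]
  constructor
  · intro h
    simpa using h.map_compl
  · intro h
    have : IsProbabilityMeasure (ℙ.map fun X : Set ℕ => Xᶜ) :=
      Measure.isProbabilityMeasure_map measurable_compl_set.aemeasurable
    have h2 := h.map_compl
    rw [Measure.map_map measurable_compl_set measurable_compl_set] at h2
    have h3 : ((fun X : Set ℕ => Xᶜ) ∘ fun X => Xᶜ) = id := by
      ext1 X; simp
    rwa [h3, Measure.map_id] at h2

/-! ### Poisson tails -/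

/-- The probability that a Poisson variable of mean `y` is at least `p`. -/
noncomputable def poissonTail (p : ℕ) (y : ℝ) : ℝ :=
  1 - Real.exp (-y) * ∑ a ∈ Finset.range p, y ^ a / a.factorial

theorem continuous_poissonTail (p : ℕ) : Continuous (poissonTail p) := by
  unfold poissonTail
  fun_prop

theorem hasSum_poissonTail (p : ℕ) (y : ℝ) :
    HasSum (fun b : ℕ => Real.exp (-y) * (y ^ (b + p) / (b + p).factorial)) (poissonTail p y) := by
  have h0 : HasSum (fun a : ℕ => y ^ a / a.factorial) (Real.exp y) := by
    rw [Real.exp_eq_exp_ℝ]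
    exact NormedSpace.expSeries_div_hasSum_exp y
  have h1 := (hasSum_nat_add_iff' p).2 (h0.mul_left (Real.exp (-y)))
  rw [← Finset.mul_sum, ← Real.exp_add, neg_add_cancel, Real.exp_zero] at h1
  exact h1

theorem poissonTail_nonneg (p : ℕ) {y : ℝ} (hy : 0 ≤ y) : 0 ≤ poissonTail p y :=
  (hasSum_poissonTail p y).nonneg fun _ => by positivity

theorem poissonTail_le_one (p : ℕ) {y : ℝ} (hy : 0 ≤ y) : poissonTail p y ≤ 1 :=
  sub_le_self _ (by positivity)

theorem poissonTail_succ_le (p : ℕ) {y : ℝ} (hy : 0 ≤ y) :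
    poissonTail (p + 1) y ≤ y / (p + 1) * poissonTail p y := by
  refine hasSum_le (fun b => ?_) (hasSum_poissonTail (p + 1) y)
    ((hasSum_poissonTail p y).mul_left (y / (p + 1)))
  rw [mul_left_comm, ← add_assoc, Nat.factorial_succ, pow_succ]
  refine mul_le_mul_of_nonneg_left ?_ (Real.exp_pos _).le
  push_cast
  rw [div_mul_div_comm, mul_comm (y ^ (b + p))]
  have : (0 : ℝ) ≤ b := b.cast_nonneg
  gcongr
  linarith

/-- A Poisson tail decays at least geometrically in its starting point. -/
theorem poissonTail_add_le (p k : ℕ) {y : ℝ} (hy : 0 ≤ y) :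
    poissonTail (p + k) y ≤ (y / (p + 1)) ^ k := by
  induction k with
  | zero => simpa using poissonTail_le_one p hy
  | succ k ih =>
    rw [← add_assoc, pow_succ']
    refine (poissonTail_succ_le _ hy).trans
      (mul_le_mul ?_ ih (poissonTail_nonneg _ hy) (by positivity))
    push_cast
    have : (0 : ℝ) ≤ k := k.cast_nonneg
    gcongr
    linarith

theorem one_sub_poissonTail_le_succ (p : ℕ) {y : ℝ} (hy : 0 < y) :
    1 - poissonTail p y ≤ p / y * (1 - poissonTail (p + 1) y) := by
  unfold poissonTail
  rw [sub_sub_cancel, sub_sub_cancel, mul_left_comm]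
  refine mul_le_mul_of_nonneg_left ?_ (Real.exp_pos _).le
  rw [Finset.sum_range_succ', mul_add, Finset.mul_sum]
  refine le_add_of_le_of_nonneg (Finset.sum_le_sum fun a ha => ?_) (by positivity)
  have ha' : (a + 1 : ℝ) ≤ p := by exact_mod_cast Finset.mem_range.1 ha
  rw [Nat.factorial_succ, pow_succ, div_mul_div_comm, div_le_div_iff₀ (by positivity) (by positivity)]
  push_cast
  have : 0 ≤ y ^ a * y * (a.factorial : ℝ) := by positivity
  nlinarith

theorem one_sub_poissonTail_le (p k : ℕ) {y : ℝ} (hy : 0 < y) :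
    1 - poissonTail p y ≤ ((p + k) / y) ^ k := by
  induction k generalizing p with
  | zero => simpa using poissonTail_nonneg p hy.le
  | succ k ih =>
    rw [pow_succ']
    refine (one_sub_poissonTail_le_succ p hy).trans
      (mul_le_mul ?_ ((ih (p + 1)).trans_eq ?_)
        (sub_nonneg.2 (poissonTail_le_one _ hy.le)) (by positivity))
    · gcongr
      push_cast
      have : (0 : ℝ) ≤ k := k.cast_nonneg
      linarith
    · push_cast
      ring

theorem tendsto_zero_of_le_pow {f : ℕ → ℝ} {g : ℕ → ℕ → ℝ} {r : ℝ} (hr1 : r < 1)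
    (hf : ∀ n, 0 ≤ f n) (hg : ∀ k, Tendsto (g k) atTop (𝓝 r))
    (hfg : ∀ k, ∀ᶠ n in atTop, f n ≤ g k n ^ k) : Tendsto f atTop (𝓝 0) := by
  refine Metric.tendsto_nhds.2 fun ε hε => ?_
  obtain ⟨k, hk⟩ := exists_pow_lt_of_lt_one hε hr1
  filter_upwards [hfg k, ((hg k).pow k).eventually_lt_const hk] with n h1 h2
  rw [Real.dist_eq, sub_zero, abs_of_nonneg (hf n)]
  exact h1.trans_lt h2

/-- The law of large numbers, below the threshold. -/
theorem tendsto_poissonTail_zero {p : ℕ → ℕ} {η y : ℝ}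
    (hp : Tendsto (fun N : ℕ => (p N : ℝ) / N) atTop (𝓝 η)) (hy : 0 ≤ y) (hyη : y < η) :
    Tendsto (fun N : ℕ => poissonTail (p N) (N * y)) atTop (𝓝 0) := by
  have hη : 0 < η := hy.trans_lt hyη
  have hpt : Tendsto p atTop atTop := by
    have h := hp.pos_mul_atTop hη tendsto_natCast_atTop_atTop
    refine tendsto_natCast_atTop_iff (R := ℝ).1 (h.congr' ?_)
    filter_upwards [eventually_gt_atTop 0] with N hN
    have : (N : ℝ) ≠ 0 := by positivity
    field_simp
  refine tendsto_zero_of_le_pow (r := y / η) (g := fun k N => N * y / ((p N - k : ℕ) + 1))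
    ((div_lt_one hη).2 hyη)
    (fun N => poissonTail_nonneg _ (by positivity)) (fun k => ?_) (fun k => ?_)
  · have h0 : Tendsto (fun N : ℕ => ((1 : ℝ) - k) / N) atTop (𝓝 0) :=
      tendsto_const_nhds.div_atTop tendsto_natCast_atTop_atTop
    have h1 := (tendsto_const_nhds (x := y)).div (hp.add h0) (by simpa using hη.ne')
    rw [add_zero] at h1
    refine h1.congr' ?_
    filter_upwards [eventually_gt_atTop 0, hpt.eventually_ge_atTop k] with N hN hk
    have : (N : ℝ) ≠ 0 := by positivity
    simp only [Pi.div_apply]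
    rw [Nat.cast_sub hk, ← add_div, div_div_eq_mul_div, mul_comm y]
    congr 1
    ring
  · filter_upwards [hpt.eventually_ge_atTop k] with N hk
    have := poissonTail_add_le (p N - k) k (y := N * y) (by positivity)
    rwa [Nat.sub_add_cancel hk] at this

/-- The law of large numbers, above the threshold. -/
theorem tendsto_poissonTail_one {p : ℕ → ℕ} {η y : ℝ}
    (hp : Tendsto (fun N : ℕ => (p N : ℝ) / N) atTop (𝓝 η)) (hη : 0 < η) (hyη : η < y) :
    Tendsto (fun N : ℕ => poissonTail (p N) (N * y)) atTop (𝓝 1) := by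
  have hy : 0 < y := hη.trans hyη
  suffices h : Tendsto (fun N : ℕ => 1 - poissonTail (p N) (N * y)) atTop (𝓝 0) by
    simpa using h.const_sub 1
  refine tendsto_zero_of_le_pow (r := η / y) (g := fun k N => (p N + k) / (N * y))
    ((div_lt_one hy).2 hyη)
    (fun N => sub_nonneg.2 (poissonTail_le_one _ (by positivity))) (fun k => ?_) (fun k => ?_)
  · have h0 : Tendsto (fun N : ℕ => (k : ℝ) / N) atTop (𝓝 0) :=
      tendsto_const_nhds.div_atTop tendsto_natCast_atTop_atTop
    have h1 := (hp.add h0).div_const y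
    rw [add_zero] at h1
    refine h1.congr fun N => ?_
    rw [← add_div, div_div]
  · filter_upwards [eventually_gt_atTop 0] with N hN
    exact one_sub_poissonTail_le _ _ (by positivity)

/-- The factor `x ^ z` may be singular at `0`; the tail compensates for it uniformly, as long as
the starting point `p` is of the order of `t`. -/
theorem zpow_mul_poissonTail_le {z : ℤ} {p : ℕ} {t x B A : ℝ} (ht : 0 ≤ t) (hx : 0 ≤ x)
    (hxB : x ≤ B) (hp : z.natAbs < p) (hA : t ≤ A * ((p - z.natAbs : ℕ) + 1)) :
    x ^ z * poissonTail p (t * x) ≤ max B 1 ^ z.natAbs + max A 1 ^ z.natAbs := by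
  have hA' : (0 : ℝ) ≤ max A 1 ^ z.natAbs := by positivity
  have hB' : (0 : ℝ) ≤ max B 1 ^ z.natAbs := by positivity
  have hT := poissonTail_le_one p (mul_nonneg ht hx)
  have hT0 := poissonTail_nonneg p (mul_nonneg ht hx)
  rcases le_or_gt 0 z with hz | hz
  · obtain ⟨n, rfl⟩ := Int.eq_ofNat_of_zero_le hz
    simp only [Int.natAbs_natCast, zpow_natCast] at *
    have : x ^ n ≤ max B 1 ^ n := pow_le_pow_left₀ hx (hxB.trans (le_max_left _ _)) n
    have : x ^ n * poissonTail p (t * x) ≤ x ^ n * 1 := by gcongr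
    linarith
  · obtain ⟨n, hn⟩ := Int.eq_ofNat_of_zero_le (neg_nonneg.2 hz.le)
    obtain rfl : z = -(n : ℤ) := by rw [← hn, neg_neg]
    simp only [Int.natAbs_neg, Int.natAbs_natCast, zpow_neg, zpow_natCast] at *
    have h1 := poissonTail_add_le (p - n) n (mul_nonneg ht hx)
    rw [Nat.sub_add_cancel hp.le] at h1
    have h2 : (t * x / ((p - n : ℕ) + 1)) ^ n ≤ x ^ n * max A 1 ^ n := by
      rw [← mul_pow]
      refine pow_le_pow_left₀ (by positivity) ?_ n
      rw [div_le_iff₀ (by positivity)]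
      have h3 : A * ((p - n : ℕ) + 1 : ℝ) ≤ max A 1 * ((p - n : ℕ) + 1) := by
        gcongr
        exact le_max_left _ _
      nlinarith
    have h3 : (x ^ n)⁻¹ * poissonTail p (t * x) ≤ (x ^ n)⁻¹ * (x ^ n * max A 1 ^ n) := by
      gcongr
      exact h1.trans h2
    have h4 : (x ^ n)⁻¹ * (x ^ n * max A 1 ^ n) ≤ max A 1 ^ n := by
      rw [← mul_assoc]
      exact mul_le_of_le_one_left hA' inv_mul_le_one
    linarith

/-! ### The contour integral -/

theorem ne_zero_of_mem_sphere {c u : ℂ} {R : ℝ} {x : ℂ} (hx : x ∈ Metric.ball c R)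
    (hu : u ∈ Metric.sphere c R) : x ≠ u := by
  rintro rfl
  exact (Metric.mem_ball.1 hx).ne (Metric.mem_sphere.1 hu)

theorem circleIntegral_exp_div_pow {c : ℂ} {R : ℝ} (h0 : (0 : ℂ) ∈ Metric.ball c R) (t : ℂ)
    (p : ℕ) : (∮ u in C(c, R), Complex.exp (t * u) / u ^ (p + 1)) =
      2 * Real.pi * Complex.I * (t ^ p / p.factorial) := by
  have hR : 0 < R := Metric.pos_of_mem_ball h0
  have hne : ∀ u ∈ Metric.sphere c R, u ≠ 0 := fun u hu => (ne_zero_of_mem_sphere h0 hu).symm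
  have hint : ∀ p : ℕ, CircleIntegrable (fun u => Complex.exp (t * u) / u ^ p) c R := fun p =>
    ContinuousOn.circleIntegrable hR.le
      (ContinuousOn.div (by fun_prop) (by fun_prop) fun u hu => pow_ne_zero _ (hne u hu))
  induction p with
  | zero =>
    have := Complex.circleIntegral_div_sub_of_differentiable_on_off_countable
      (f := fun u => Complex.exp (t * u)) Set.countable_empty h0 (by fun_prop)
      (fun _ _ => by fun_prop)
    simpa using this
  | succ p ih =>
    -- the integrand is the derivative of `exp (t u) / u ^ (p + 1)` up to a lower order term
    have hd := circleIntegral.integral_eq_zero_of_hasDerivWithinAt (c := c) hR.le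
      (f := fun u => Complex.exp (t * u) / u ^ (p + 1))
      (f' := fun u => t * (Complex.exp (t * u) / u ^ (p + 1)) -
        (p + 1) * (Complex.exp (t * u) / u ^ (p + 1 + 1))) fun u hu => by
          have hu0 := hne u hu
          have h1 : HasDerivAt (fun u => Complex.exp (t * u)) (Complex.exp (t * u) * (t * 1)) u :=
            ((hasDerivAt_id u).const_mul t).cexp
          refine ((h1.div (hasDerivAt_pow (p + 1) u) (pow_ne_zero _ hu0)).congr_deriv
            ?_).hasDerivWithinAt
          push_cast
          field_simp
          ring
    have hsub := circleIntegral.integral_sub ((hint (p + 1)).const_smul (a := t))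
      ((hint (p + 1 + 1)).const_smul (a := (p + 1 : ℂ)))
    simp only [Pi.smul_apply, smul_eq_mul] at hsub
    rw [hsub, circleIntegral.integral_const_mul,
      circleIntegral.integral_const_mul, ih, sub_eq_zero] at hd
    have hp : (p + 1 : ℂ) ≠ 0 := by exact_mod_cast p.succ_ne_zero
    refine mul_left_cancel₀ hp (hd.symm.trans ?_)
    rw [Nat.factorial_succ]
    push_cast
    field_simp
    ring

/-- The residues of `exp (t u) / (u ^ p (x - u))` at `x` and at `0`, the latter being the start of
the exponential series. -/
theorem pow_mul_circleIntegral_exp_div {c x : ℂ} {R : ℝ} (h0 : (0 : ℂ) ∈ Metric.ball c R)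
    (hx : x ∈ Metric.ball c R) (t : ℂ) (p : ℕ) :
    x ^ p * (∮ u in C(c, R), Complex.exp (t * u) / (u ^ p * (x - u))) =
      -(2 * Real.pi * Complex.I *
        (Complex.exp (t * x) - ∑ a ∈ Finset.range p, (t * x) ^ a / a.factorial)) := by
  have hR : 0 < R := Metric.pos_of_mem_ball h0
  have hne : ∀ u ∈ Metric.sphere c R, u ≠ 0 := fun u hu => (ne_zero_of_mem_sphere h0 hu).symm
  have hne' : ∀ u ∈ Metric.sphere c R, x - u ≠ 0 := fun u hu =>
    sub_ne_zero.2 (ne_zero_of_mem_sphere hx hu)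
  induction p with
  | zero =>
    have := Complex.circleIntegral_div_sub_of_differentiable_on_off_countable
      (f := fun u => Complex.exp (t * u)) Set.countable_empty hx (by fun_prop)
      (fun _ _ => by fun_prop)
    simp only [pow_zero, one_mul, Finset.range_zero, Finset.sum_empty, sub_zero]
    rw [← this, ← neg_one_mul, ← circleIntegral.integral_const_mul]
    refine circleIntegral.integral_congr hR.le fun u _ => ?_
    rw [← neg_sub u x, div_neg, neg_one_mul]
  | succ p ih =>
    have h1 : x * (∮ u in C(c, R), Complex.exp (t * u) / (u ^ (p + 1) * (x - u))) =
        (∮ u in C(c, R), Complex.exp (t * u) / (u ^ p * (x - u))) +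
          ∮ u in C(c, R), Complex.exp (t * u) / u ^ (p + 1) := by
      rw [← circleIntegral.integral_const_mul, ← circleIntegral.integral_add]
      · refine circleIntegral.integral_congr hR.le fun u hu => ?_
        have := hne u hu
        have := hne' u hu
        field_simp
        ring
      · exact ContinuousOn.circleIntegrable hR.le (ContinuousOn.div (by fun_prop) (by fun_prop)
          fun u hu => mul_ne_zero (pow_ne_zero _ (hne u hu)) (hne' u hu))
      · exact ContinuousOn.circleIntegrable hR.le (ContinuousOn.div (by fun_prop) (by fun_prop)
          fun u hu => pow_ne_zero _ (hne u hu))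
    rw [pow_succ, mul_assoc, h1, mul_add, ih, circleIntegral_exp_div_pow h0,
      Finset.sum_range_succ, mul_pow]
    ring

/-- For real `x` and `t`, the contour integral is a Poisson tail. -/
theorem circleIntegral_exp_div_eq_poissonTail {c : ℂ} {R x : ℝ} (h0 : (0 : ℂ) ∈ Metric.ball c R)
    (hx : (x : ℂ) ∈ Metric.ball c R) (t : ℝ) (p : ℕ) :
    (x : ℂ) ^ p * Complex.exp (-(t * x)) *
        (∮ u in C(c, R), Complex.exp (t * u) / (u ^ p * (x - u))) =
      -(2 * Real.pi * Complex.I * (poissonTail p (t * x) : ℝ)) := by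
  rw [mul_right_comm, pow_mul_circleIntegral_exp_div h0 hx, poissonTail]
  push_cast
  have : Complex.exp (-(t * x)) * Complex.exp (t * x) = 1 := by
    rw [← Complex.exp_add, neg_add_cancel, Complex.exp_zero]
  linear_combination (-2 * Real.pi * Complex.I) * this

/-! ### The polynomials of a chain and of its dual -/

open Polynomial in
theorem natDegree_chainPoly {b : ℕ → ℝ} (d : ℕ → ℝ) (hb : ∀ n, 0 < b n) :
    ∀ n, (chainPoly b d n).natDegree = n ∧ 0 < (-1) ^ n * (chainPoly b d n).leadingCoeff
  | 0 => by simp [chainPoly]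
  | 1 => by
    have h1 : C (b 0)⁻¹ * (C (b 0 + d 0) - X) = C (-(b 0)⁻¹) * (X - C (b 0 + d 0)) := by
      rw [C_neg]; ring
    have hb0 := hb 0
    rw [chainPoly, h1, natDegree_C_mul (by simp [hb0.ne']), leadingCoeff_mul, natDegree_X_sub_C,
      leadingCoeff_X_sub_C, leadingCoeff_C]
    simp [hb0]
  | n + 2 => by
    obtain ⟨h1, h1'⟩ := natDegree_chainPoly d hb (n + 1)
    obtain ⟨h0, -⟩ := natDegree_chainPoly d hb n
    have hb1 := hb (n + 1)
    set p := chainPoly b d (n + 1) with hp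
    set q := chainPoly b d n with hq
    have hp0 : p ≠ 0 := by
      intro h; rw [h] at h1'; simp at h1'
    have h2 : chainPoly b d (n + 2) = C (-(b (n + 1))⁻¹) *
        ((X - C (b (n + 1) + d (n + 1))) * p + C (d (n + 1)) * q) := by
      rw [chainPoly, ← hp, ← hq, C_neg]; ring
    have h3 : ((X - C (b (n + 1) + d (n + 1))) * p).natDegree = n + 2 := by
      rw [natDegree_mul (X_sub_C_ne_zero _) hp0, natDegree_X_sub_C, h1]; ring
    have h4 : (C (d (n + 1)) * q).natDegree < ((X - C (b (n + 1) + d (n + 1))) * p).natDegree := by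
      rw [h3]
      exact (natDegree_C_mul_le _ _).trans_lt (by omega)
    rw [h2, natDegree_C_mul (by simp [hb1.ne']), leadingCoeff_mul,
      natDegree_add_eq_left_of_natDegree_lt h4, h3,
      leadingCoeff_add_of_degree_lt' (degree_lt_degree h4), leadingCoeff_mul,
      leadingCoeff_X_sub_C, leadingCoeff_C]
    refine ⟨rfl, ?_⟩
    have : (-1 : ℝ) ^ (n + 2) * (-(b (n + 1))⁻¹ * (1 * p.leadingCoeff)) =
        (b (n + 1))⁻¹ * ((-1) ^ (n + 1) * p.leadingCoeff) := by ring
    rw [this]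
    positivity

theorem degree_chainPoly {b : ℕ → ℝ} (d : ℕ → ℝ) (hb : ∀ n, 0 < b n) (n : ℕ) :
    (chainPoly b d n).degree = n := by
  obtain ⟨h, h'⟩ := natDegree_chainPoly d hb n
  rw [Polynomial.degree_eq_natDegree, h]
  intro h0
  simp [h0] at h'

theorem symmetrizing_pos {b d : ℕ → ℝ} (hb : ∀ n, 0 < b n) (hd : ∀ n, 0 < d (n + 1)) (n : ℕ) :
    0 < symmetrizing b d n :=
  Finset.prod_pos fun k _ => div_pos (hb k) (hd k)

namespace Rates

variable (𝒟 : Rates)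

theorem symm_pos (n : ℕ) : 0 < 𝒟.symm n := symmetrizing_pos 𝒟.birth_pos 𝒟.death_pos n

theorem dualSymm_pos (n : ℕ) : 0 < 𝒟.dualSymm n :=
  symmetrizing_pos 𝒟.death_pos (fun n => 𝒟.birth_pos (n + 1)) n

theorem degree_dualQ (n : ℕ) : (𝒟.dualQ n).degree = n := degree_chainPoly _ 𝒟.death_pos n

/-- Detailed balance. -/
theorem symm_succ (n : ℕ) : 𝒟.symm (n + 1) * 𝒟.death (n + 1) = 𝒟.symm n * 𝒟.birth n := by
  rw [symm, symmetrizing, Finset.prod_range_succ, mul_assoc,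
    div_mul_cancel₀ _ (𝒟.death_pos n).ne', symm, symmetrizing]

open Polynomial in
theorem birth_mul_Q (n : ℕ) : C (𝒟.birth (n + 1)) * 𝒟.Q (n + 2) =
    (C (𝒟.birth (n + 1) + 𝒟.death (n + 1)) - X) * 𝒟.Q (n + 1) - C (𝒟.death (n + 1)) * 𝒟.Q n := by
  rw [Q, chainPoly, ← mul_assoc, ← C_mul, mul_inv_cancel₀ (𝒟.birth_pos _).ne', C_1, one_mul, Q, Q]

open Polynomial in
theorem birth_mul_Q_one : C (𝒟.birth 0) * 𝒟.Q 1 = C (𝒟.birth 0) - X := by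
  rw [Q, chainPoly, ← mul_assoc, ← C_mul, mul_inv_cancel₀ (𝒟.birth_pos _).ne', C_1, one_mul,
    𝒟.death_zero, add_zero]

open Polynomial in
/-- The recursion of the `Qₙ`, summed up to `n`. -/
theorem X_mul_sum_Q (n : ℕ) : X * ∑ k ∈ Finset.range (n + 1), C (𝒟.symm k) * 𝒟.Q k =
    C (𝒟.birth n * 𝒟.symm n) * (𝒟.Q n - 𝒟.Q (n + 1)) := by
  induction n with
  | zero =>
    have h := 𝒟.birth_mul_Q_one
    have h0 : 𝒟.Q 0 = 1 := by rw [Q, chainPoly]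
    have h1 : 𝒟.symm 0 = 1 := by simp [symm, symmetrizing]
    simp only [zero_add, Finset.sum_range_one, h0, h1, mul_one, C_1]
    linear_combination h
  | succ n ih =>
    rw [Finset.sum_range_succ, mul_add, ih]
    have h := 𝒟.birth_mul_Q n
    have h1 := congrArg (C (R := ℝ)) (𝒟.symm_succ n)
    simp only [C_mul, C_add] at h h1 ⊢
    linear_combination C (𝒟.symm (n + 1)) * h - (𝒟.Q n - 𝒟.Q (n + 1)) * h1

open Polynomial in
/-- The dual polynomials are the kernel polynomials of the `Qₙ`. -/
theorem dualQ_eq_sum : ∀ n, 𝒟.dualQ n = ∑ k ∈ Finset.range (n + 1), C (𝒟.symm k) * 𝒟.Q k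
  | 0 => by simp [dualQ, chainPoly, symm, symmetrizing, Q]
  | 1 => by
    have h := 𝒟.birth_mul_Q_one
    have h1 := congrArg (C (R := ℝ)) (𝒟.symm_succ 0)
    have hd : C (𝒟.death 1) ≠ 0 := by simpa using (𝒟.death_pos 0).ne'
    have h0 : 𝒟.Q 0 = 1 := by rw [Q, chainPoly]
    have h2 : 𝒟.symm 0 = 1 := by simp [symm, symmetrizing]
    apply mul_left_cancel₀ hd
    rw [dualQ, chainPoly, ← mul_assoc, dualBirth, ← C_mul, mul_inv_cancel₀ (𝒟.death_pos _).ne',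
      C_1, one_mul, Finset.sum_range_succ, Finset.sum_range_one, h0, dualDeath]
    simp only [h2, C_mul, C_add, C_1, zero_add] at h1 ⊢
    linear_combination -h - 𝒟.Q 1 * h1
  | n + 2 => by
    have h1 := congrArg (C (R := ℝ)) (𝒟.symm_succ (n + 1))
    have hd : C (𝒟.death (n + 2)) ≠ 0 := by simpa using (𝒟.death_pos (n + 1)).ne'
    have hX := 𝒟.X_mul_sum_Q (n + 1)
    have ih1 := dualQ_eq_sum (n + 1)
    have ih0 := dualQ_eq_sum n
    apply mul_left_cancel₀ hd
    rw [dualQ, chainPoly, ← mul_assoc, dualBirth, ← C_mul, mul_inv_cancel₀ (𝒟.death_pos _).ne',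
      C_1, one_mul, ← dualQ, ← dualQ, ih1, ih0, dualDeath, sub_mul, hX,
      Finset.sum_range_succ _ (n + 2), Finset.sum_range_succ _ (n + 1)]
    simp only [C_mul, C_add] at h1 ⊢
    linear_combination -𝒟.Q (n + 2) * h1

open Polynomial in
theorem X_mul_dualQ (n : ℕ) :
    X * 𝒟.dualQ n = C (𝒟.birth n * 𝒟.symm n) * (𝒟.Q n - 𝒟.Q (n + 1)) := by
  rw [dualQ_eq_sum, X_mul_sum_Q]

end Rates

/-! ### Orthogonal polynomials -/

open Polynomial in
theorem mem_submodule_of_degree_lt {q : ℕ → ℝ[X]} (hq : ∀ n, (q n).degree = n)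
    (V : Submodule ℝ ℝ[X]) (k : ℕ) :
    (∀ j < k, q j ∈ V) → ∀ p : ℝ[X], p.degree < k → p ∈ V := by
  induction k with
  | zero =>
    intro _ p hp
    have : p = 0 := by simpa using hp
    simp [this]
  | succ k ih =>
    intro hV p hp
    have hl : (q k).coeff k ≠ 0 := by
      have : (q k).natDegree = k := natDegree_eq_of_degree_eq_some (hq k)
      rw [← this, this]
      have h0 : q k ≠ 0 := by
        intro h; simpa [h] using hq k
      rw [show (q k).coeff k = (q k).leadingCoeff by rw [leadingCoeff, this]]
      exact leadingCoeff_ne_zero.2 h0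
    have h1 : p - (p.coeff k / (q k).coeff k) • q k ∈ V := by
      refine ih (fun j hj => hV j (hj.trans k.lt_succ_self)) _ ?_
      rw [degree_lt_iff_coeff_zero]
      intro m hm
      rw [coeff_sub, coeff_smul, smul_eq_mul]
      rcases hm.eq_or_lt with rfl | hm
      · rw [div_mul_cancel₀ _ hl, sub_self]
      · rw [coeff_eq_zero_of_degree_lt (p := p) (n := m),
          coeff_eq_zero_of_degree_lt (p := q k) (n := m), mul_zero, sub_zero]
        · rw [hq]; exact_mod_cast hm
        · exact hp.trans_le (by exact_mod_cast hm)
    simpa using V.add_mem h1 (V.smul_mem (p.coeff k / (q k).coeff k) (hV k k.lt_succ_self))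

theorem integrable_polynomial {W : Measure ℝ} (hW : ∀ k : ℕ, Integrable (fun x : ℝ => x ^ k) W)
    (p : Polynomial ℝ) : Integrable (fun x => p.eval x) W := by
  simp only [Polynomial.eval_eq_sum_range]
  exact integrable_finsetSum _ fun k _ => (hW k).const_mul _

/-- Integration of polynomials against a measure with finite moments. -/
noncomputable def momentFunctional {W : Measure ℝ}
    (hW : ∀ k : ℕ, Integrable (fun x : ℝ => x ^ k) W) : Polynomial ℝ →ₗ[ℝ] ℝ where
  toFun p := ∫ x, p.eval x ∂W
  map_add' p q := by
    simp only [Polynomial.eval_add]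
    exact integral_add (integrable_polynomial hW p) (integrable_polynomial hW q)
  map_smul' a p := by
    simp [Polynomial.eval_smul, integral_const_mul]

theorem IsOrthonormalPolys.degree_eq {W : Measure ℝ} {P : ℕ → Polynomial ℝ}
    (h : IsOrthonormalPolys W P) (k : ℕ) : (P k).degree = k := by
  rw [Polynomial.degree_eq_natDegree, h.degree]
  intro h0
  simpa [h0] using h.leading k

theorem IsOrthonormalPolys.integral_mul_eq_zero {W : Measure ℝ}
    (hW : ∀ k : ℕ, Integrable (fun x : ℝ => x ^ k) W) {P : ℕ → Polynomial ℝ}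
    (h : IsOrthonormalPolys W P) {k : ℕ} {p : Polynomial ℝ} (hp : p.degree < k) :
    momentFunctional hW (P k * p) = 0 := by
  refine mem_submodule_of_degree_lt h.degree_eq
    (LinearMap.ker (momentFunctional hW ∘ₗ LinearMap.mulLeft ℝ (P k))) k (fun j hj => ?_) p hp
  have := h.orthonormal k j
  rw [if_neg hj.ne'] at this
  simpa [momentFunctional] using this

/-- Orthonormal polynomials are determined by their weight. -/
theorem IsOrthonormalPolys.unique {W : Measure ℝ}
    (hW : ∀ k : ℕ, Integrable (fun x : ℝ => x ^ k) W) {P P' : ℕ → Polynomial ℝ}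
    (h : IsOrthonormalPolys W P) (h' : IsOrthonormalPolys W P') (k : ℕ) : P' k = P k := by
  have horth : ∀ {P : ℕ → Polynomial ℝ}, IsOrthonormalPolys W P → ∀ i,
      momentFunctional hW (P i * P i) = 1 := fun hP i => by
    have := hP.orthonormal i i
    rw [if_pos rfl] at this
    simpa [momentFunctional] using this
  set r := (P' k).leadingCoeff / (P k).leadingCoeff with hr
  have hr0 : 0 < r := div_pos (h'.leading k) (h.leading k)
  have hdiff : (P' k - r • P k).degree < k := by
    rw [Polynomial.degree_lt_iff_coeff_zero]
    intro m hm
    rw [Polynomial.coeff_sub, Polynomial.coeff_smul, smul_eq_mul]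
    rcases hm.eq_or_lt with rfl | hm
    · have h1 : (P k).coeff k = (P k).leadingCoeff := by
        rw [Polynomial.leadingCoeff, h.degree]
      have h2 : (P' k).coeff k = (P' k).leadingCoeff := by
        rw [Polynomial.leadingCoeff, h'.degree]
      rw [h1, h2, hr, div_mul_cancel₀ _ (h.leading k).ne', sub_self]
    · rw [Polynomial.coeff_eq_zero_of_degree_lt, Polynomial.coeff_eq_zero_of_degree_lt, mul_zero,
        sub_zero]
      · rw [h.degree_eq]; exact_mod_cast hm
      · rw [h'.degree_eq]; exact_mod_cast hm
  set D := P' k - r • P k with hD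
  -- `D` is orthogonal to all polynomials of degree less than `k`
  have hD0 : ∀ p : Polynomial ℝ, p.degree < k → momentFunctional hW (D * p) = 0 := by
    intro p hp
    rw [hD, sub_mul, smul_mul_assoc, map_sub, map_smul, h.integral_mul_eq_zero hW hp,
      h'.integral_mul_eq_zero hW hp]
    simp
  -- hence its coefficients in the basis `P` vanish
  have hDz : ∀ m : ℕ, m ≤ k → D.degree < m → D = 0 := by
    intro m
    induction m with
    | zero => intro _ hm; simpa using hm
    | succ m ih =>
      intro hmk hm
      refine ih (by omega) ?_
      set a := D.coeff m / (P m).coeff m with ha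
      have hl : (P m).coeff m ≠ 0 := by
        have := (h.leading m).ne'
        rwa [Polynomial.leadingCoeff, h.degree] at this
      have h1 : (D - a • P m).degree < m := by
        rw [Polynomial.degree_lt_iff_coeff_zero]
        intro l hl'
        rw [Polynomial.coeff_sub, Polynomial.coeff_smul, smul_eq_mul]
        rcases hl'.eq_or_lt with rfl | hl'
        · rw [ha, div_mul_cancel₀ _ hl, sub_self]
        · rw [Polynomial.coeff_eq_zero_of_degree_lt, Polynomial.coeff_eq_zero_of_degree_lt,
            mul_zero, sub_zero]
          · rw [h.degree_eq]; exact_mod_cast hl'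
          · exact hm.trans_le (by exact_mod_cast hl')
      have h2 := h.integral_mul_eq_zero hW h1
      rw [mul_sub, mul_smul_comm, map_sub, map_smul, horth h, mul_comm, hD0 (P m) (by
        rw [h.degree_eq]; exact_mod_cast hmk)] at h2
      have ha0 : a = 0 := by simpa using h2
      rwa [ha0, zero_smul, sub_zero] at h1
  have hP : P' k = r • P k := sub_eq_zero.1 (hDz k le_rfl hdiff)
  have h1 := horth h' k
  rw [hP, smul_mul_smul_comm, map_smul, horth h, smul_eq_mul, mul_one] at h1
  have : r = 1 := by nlinarith
  rw [hP, this, one_smul]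

/-- Normalizing the polynomials of a chain, whose leading coefficients alternate in sign. -/
theorem isOrthonormalPolys_of_isSpectralMeasure {b d : ℕ → ℝ} (hb : ∀ n, 0 < b n)
    {p : ℕ → ℝ} (hp : ∀ n, 0 < p n) {W : Measure ℝ}
    (hW : IsSpectralMeasure (chainPoly b d) p W) :
    IsOrthonormalPolys W fun k => Polynomial.C ((-1) ^ k * √(p k)) * chainPoly b d k where
  degree k := by
    rw [Polynomial.natDegree_C_mul (by simp [(hp k).le, (hp k).ne']),
      (natDegree_chainPoly d hb k).1]
  leading k := by
    rw [Polynomial.leadingCoeff_mul, Polynomial.leadingCoeff_C, mul_right_comm]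
    exact mul_pos (natDegree_chainPoly d hb k).2 (Real.sqrt_pos.2 (hp k))
  integrable i j := by
    simpa only [Polynomial.eval_mul] using integrable_polynomial hW.moments
      (Polynomial.C ((-1) ^ i * √(p i)) * chainPoly b d i *
        (Polynomial.C ((-1) ^ j * √(p j)) * chainPoly b d j))
  orthonormal i j := by
    simp only [Polynomial.eval_mul, Polynomial.eval_C]
    have : ∀ x, (-1) ^ i * √(p i) * (chainPoly b d i).eval x *
        ((-1) ^ j * √(p j) * (chainPoly b d j).eval x) =
        ((-1) ^ i * √(p i) * ((-1) ^ j * √(p j))) *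
          ((chainPoly b d i).eval x * (chainPoly b d j).eval x) := fun x => by ring
    simp only [this]
    rw [integral_const_mul, hW.orthogonal]
    split_ifs with h
    · subst h
      have h1 := Real.mul_self_sqrt (hp i).le
      have h2 : ((-1 : ℝ) ^ i) * (-1) ^ i = 1 := by rw [← mul_pow]; simp
      rw [mul_mul_mul_comm, h1, h2, one_mul, mul_one_div_cancel (hp i).ne']
    · rw [mul_zero]

/-! ### Moment determinacy and the dual spectral measure -/

theorem measure_compl_Icc_eq_zero_of_moments {μ ν : Measure ℝ} {M : ℝ} (hM : 0 ≤ M)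
    (hμ : ∀ k : ℕ, Integrable (fun x : ℝ => x ^ k) μ)
    (hν : ∀ k : ℕ, Integrable (fun x : ℝ => x ^ k) ν)
    (hμ0 : μ (Set.Iio 0) = 0) (hν0 : ν (Set.Icc 0 M)ᶜ = 0)
    (h : ∀ k : ℕ, ∫ x, x ^ k ∂μ = ∫ x, x ^ k ∂ν) : μ (Set.Icc 0 M)ᶜ = 0 := by
  have : IsFiniteMeasure μ := by simpa [integrable_const_iff] using hμ 0
  have : IsFiniteMeasure ν := by simpa [integrable_const_iff] using hν 0
  have hμ0' : ∀ᵐ x ∂μ, 0 ≤ x := by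
    rw [ae_iff]; simpa [Set.Iio] using hμ0
  have hν0' : ∀ᵐ x ∂ν, x ∈ Set.Icc 0 M := by
    rw [ae_iff]; exact hν0
  have hmom : ∀ k : ℕ, ∫ x, x ^ k ∂ν ≤ M ^ k * ν.real Set.univ := fun k => by
    have := integral_mono_ae (hν k) (integrable_const (M ^ k)) (by
      filter_upwards [hν0'] with x hx
      exact pow_le_pow_left₀ hx.1 hx.2 k)
    simpa [mul_comm] using this
  have key : ∀ r, M < r → μ (Set.Ici r) = 0 := by
    intro r hr
    have hr0 : 0 < r := hM.trans_lt hr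
    have hle : ∀ k : ℕ, μ.real (Set.Ici r) ≤ (M / r) ^ k * ν.real Set.univ := by
      intro k
      have h1 := mul_meas_ge_le_integral_of_nonneg (μ := μ) (f := fun x : ℝ => x ^ k)
        (by filter_upwards [hμ0'] with x hx using pow_nonneg hx k) (hμ k) (r ^ k)
      have h2 : μ.real (Set.Ici r) ≤ μ.real {x | r ^ k ≤ x ^ k} :=
        measureReal_mono fun x hx => pow_le_pow_left₀ hr0.le hx k
      have h3 : r ^ k * μ.real (Set.Ici r) ≤ r ^ k * μ.real {x | r ^ k ≤ x ^ k} := by gcongr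
      have h4 := (h3.trans h1).trans ((h k).trans_le (hmom k))
      rw [div_pow, div_mul_eq_mul_div, le_div_iff₀ (by positivity)]
      linarith
    have hlim : Tendsto (fun k : ℕ => (M / r) ^ k * ν.real Set.univ) atTop (𝓝 0) := by
      simpa using (tendsto_pow_atTop_nhds_zero_of_lt_one (by positivity)
        ((div_lt_one hr0).2 hr)).mul_const (ν.real Set.univ)
    have h0 : μ.real (Set.Ici r) ≤ 0 := ge_of_tendsto' hlim hle
    exact (measureReal_eq_zero_iff).1 (le_antisymm h0 measureReal_nonneg)
  have hsub : (Set.Icc 0 M)ᶜ ⊆ Set.Iio 0 ∪ ⋃ n : ℕ, Set.Ici (M + 1 / ((n : ℝ) + 1)) := by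
    intro x hx
    by_cases h0 : x < 0
    · exact Or.inl h0
    · have hx' : M < x := by
        by_contra hc
        exact hx ⟨not_lt.1 h0, not_lt.1 hc⟩
      obtain ⟨n, hn⟩ := exists_nat_one_div_lt (sub_pos.2 hx')
      refine Or.inr (Set.mem_iUnion.2 ⟨n, ?_⟩)
      simp only [Set.mem_Ici]
      linarith
  refine measure_mono_null hsub (measure_union_null hμ0 (measure_iUnion_null fun n => key _ ?_))
  have : (0 : ℝ) < 1 / ((n : ℝ) + 1) := by positivity
  linarith

/-- On the half-line, a compactly supported measure is determined by its moments, even among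
measures of unbounded support: high moments bound the support, and Weierstrass approximation does
the rest. -/
theorem eq_of_moments_eq {μ ν : Measure ℝ} {M : ℝ} (hM : 0 ≤ M)
    (hμ : ∀ k : ℕ, Integrable (fun x : ℝ => x ^ k) μ)
    (hν : ∀ k : ℕ, Integrable (fun x : ℝ => x ^ k) ν)
    (hμ0 : μ (Set.Iio 0) = 0) (hν0 : ν (Set.Icc 0 M)ᶜ = 0)
    (h : ∀ p : Polynomial ℝ, ∫ x, p.eval x ∂μ = ∫ x, p.eval x ∂ν) : μ = ν := by
  have hμM := measure_compl_Icc_eq_zero_of_moments hM hμ hν hμ0 hν0 fun k => by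
    simpa using h (Polynomial.X ^ k)
  have : IsFiniteMeasure μ := by simpa [integrable_const_iff] using hμ 0
  have : IsFiniteMeasure ν := by simpa [integrable_const_iff] using hν 0
  refine ext_of_forall_integral_eq_of_IsFiniteMeasure fun f => ?_
  have key : ∀ (ρ : Measure ℝ) [IsFiniteMeasure ρ],
      (∀ k : ℕ, Integrable (fun x : ℝ => x ^ k) ρ) → ρ (Set.Icc 0 M)ᶜ = 0 →
      ∀ (ε : ℝ) (p : Polynomial ℝ), (∀ x ∈ Set.Icc 0 M, |p.eval x - f x| < ε) →
      |∫ x, p.eval x ∂ρ - ∫ x, f x ∂ρ| ≤ ε * ρ.real Set.univ := by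
    intro ρ _ hρ hρM ε p hp
    rw [← integral_sub (integrable_polynomial hρ p) (f.integrable ρ), ← Real.norm_eq_abs]
    refine norm_integral_le_of_norm_le_const ?_
    have : ∀ᵐ x ∂ρ, x ∈ Set.Icc 0 M := by rw [ae_iff]; exact hρM
    filter_upwards [this] with x hx
    exact (hp x hx).le
  set T := μ.real Set.univ + ν.real Set.univ with hT
  have hT0 : 0 ≤ T := by positivity
  have hle : ∀ ε : ℝ, 0 < ε → |∫ x, f x ∂μ - ∫ x, f x ∂ν| ≤ ε * T := by
    intro ε hε
    obtain ⟨p, hp⟩ := exists_polynomial_near_of_continuousOn 0 M f f.continuous.continuousOn ε hε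
    have h1 := key μ hμ hμM ε p hp
    have h2 := key ν hν hν0 ε p hp
    rw [h p] at h1
    rw [abs_le] at h1 h2 ⊢
    constructor <;> nlinarith
  have h0 : |∫ x, f x ∂μ - ∫ x, f x ∂ν| ≤ 0 := by
    refine le_of_forall_pos_le_add fun ε hε => ?_
    refine (hle (ε / (T + 1)) (by positivity)).trans ?_
    rw [zero_add, div_mul_eq_mul_div, div_le_iff₀ (by positivity)]
    nlinarith
  exact sub_eq_zero.1 (abs_nonpos_iff.1 h0)

theorem measure_compl_Icc_support {w : Measure ℝ} (hcompact : IsCompact w.support) :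
    w (Set.Icc (lowerEnd w) (upperEnd w))ᶜ = 0 :=
  measure_mono_null (Set.compl_subset_compl.2 (subset_Icc_csInf_csSup
    hcompact.bddBelow hcompact.bddAbove)) Measure.measure_compl_support

theorem IsSpectralMeasure.isFiniteMeasure {q : ℕ → Polynomial ℝ} {p : ℕ → ℝ} {w : Measure ℝ}
    (h : IsSpectralMeasure q p w) : IsFiniteMeasure w := by
  simpa [integrable_const_iff] using h.moments 0

theorem support_subset_Ici {w : Measure ℝ} (h : w (Set.Iio 0) = 0) :
    w.support ⊆ Set.Ici 0 := by
  refine Measure.support_subset_of_isClosed isClosed_Ici ?_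
  rw [mem_ae_iff]
  simpa using h

theorem support_nonempty {𝒟 : Rates} {w : Measure ℝ} (hw : IsSpectralMeasure 𝒟.Q 𝒟.symm w) :
    w.support.Nonempty := by
  rw [Measure.nonempty_support_iff]
  rintro rfl
  have := hw.orthogonal 0 0
  simp [(𝒟.symm_pos 0).ne] at this

theorem upperEnd_nonneg {𝒟 : Rates} {w : Measure ℝ} (hw : IsSpectralMeasure 𝒟.Q 𝒟.symm w)
    (hcompact : IsCompact w.support) : 0 ≤ upperEnd w := by
  obtain ⟨x, hx⟩ := support_nonempty hw
  exact (support_subset_Ici hw.nonneg hx).trans (le_csSup hcompact.bddAbove hx)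

theorem lowerEnd_nonneg {𝒟 : Rates} {w : Measure ℝ} (hw : IsSpectralMeasure 𝒟.Q 𝒟.symm w) :
    0 ≤ lowerEnd w :=
  le_csInf (support_nonempty hw) fun _ hx => support_subset_Ici hw.nonneg hx

/-- The spectral measure of the dual chain is `x dw(x)`, normalized. -/
theorem dual_eq_withDensity {𝒟 : Rates} {w w' : Measure ℝ}
    (hw : IsSpectralMeasure 𝒟.Q 𝒟.symm w) (hw' : IsSpectralMeasure 𝒟.dualQ 𝒟.dualSymm w')
    (hcompact : IsCompact w.support) :
    w' = w.withDensity fun x => ENNReal.ofReal (x / 𝒟.birth 0) := by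
  have hb := 𝒟.birth_pos 0
  have hw0 : ∀ᵐ x ∂w, 0 ≤ x := by
    rw [ae_iff]; simpa [Set.Iio] using hw.nonneg
  have hmeas : Measurable fun x : ℝ => ENNReal.ofReal (x / 𝒟.birth 0) := by fun_prop
  have hfin : ∀ᵐ x ∂w, ENNReal.ofReal (x / 𝒟.birth 0) < ⊤ := ae_of_all _ fun _ => by simp
  set ν := w.withDensity fun x => ENNReal.ofReal (x / 𝒟.birth 0) with hν
  have hac : ν ≪ w := withDensity_absolutelyContinuous _ _
  have hint : ∀ p : Polynomial ℝ, ∫ x, p.eval x ∂ν =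
      (𝒟.birth 0)⁻¹ * ∫ x, (Polynomial.X * p).eval x ∂w := by
    intro p
    rw [hν, integral_withDensity_eq_integral_toReal_smul hmeas hfin, ← integral_const_mul]
    refine integral_congr_ae ?_
    filter_upwards [hw0] with x hx
    rw [ENNReal.toReal_ofReal (by positivity)]
    simp
    ring
  have hmom : ∀ k : ℕ, Integrable (fun x : ℝ => x ^ k) ν := by
    intro k
    rw [hν, integrable_withDensity_iff_integrable_smul' hmeas hfin]
    refine ((hw.moments (k + 1)).const_mul (𝒟.birth 0)⁻¹).congr ?_
    filter_upwards [hw0] with x hx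
    rw [ENNReal.toReal_ofReal (by positivity), smul_eq_mul]
    ring
  have hQ0 : 𝒟.Q 0 = 1 := by rw [Rates.Q, chainPoly]
  have hdQ0 : 𝒟.dualQ 0 = 1 := by rw [Rates.dualQ, chainPoly]
  have hs0 : 𝒟.symm 0 = 1 := by simp [Rates.symm, symmetrizing]
  have hds0 : 𝒟.dualSymm 0 = 1 := by simp [Rates.dualSymm, symmetrizing]
  have hQint : ∀ i, ∫ x, (𝒟.Q i).eval x ∂w = if i = 0 then 1 else 0 := fun i => by
    simpa [hQ0, hs0] using hw.orthogonal i 0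
  refine eq_of_moments_eq (M := upperEnd w) (upperEnd_nonneg hw hcompact) hw'.moments hmom
    hw'.nonneg (hac ?_) fun p => ?_
  · exact measure_mono_null (Set.compl_subset_compl.2
      (Set.Icc_subset_Icc_left (lowerEnd_nonneg hw))) (measure_compl_Icc_support hcompact)
  · have hker : p ∈ LinearMap.ker (momentFunctional hw'.moments - momentFunctional hmom) := by
      refine mem_submodule_of_degree_lt 𝒟.degree_dualQ _ (p.natDegree + 1) (fun i _ => ?_) p
        (Polynomial.degree_le_natDegree.trans_lt (by exact_mod_cast p.natDegree.lt_succ_self))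
      have h1 : ∫ x, (𝒟.dualQ i).eval x ∂w' = if i = 0 then 1 else 0 := by
        simpa [hdQ0, hds0] using hw'.orthogonal i 0
      have h2 : ∫ x, (𝒟.dualQ i).eval x ∂ν = if i = 0 then 1 else 0 := by
        rw [hint, 𝒟.X_mul_dualQ]
        simp only [Polynomial.eval_mul, Polynomial.eval_sub, Polynomial.eval_C]
        rw [integral_const_mul, integral_sub (integrable_polynomial hw.moments _)
          (integrable_polynomial hw.moments _), hQint, hQint, if_neg i.succ_ne_zero]
        split_ifs with hi
        · rw [hi, hs0]
          field_simp
          ring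
        · simp
      simpa [momentFunctional, sub_eq_zero] using h1.trans h2.symm
    simpa [momentFunctional, sub_eq_zero] using hker

theorem dual_absolutelyContinuous {𝒟 : Rates} {w w' : Measure ℝ}
    (hw : IsSpectralMeasure 𝒟.Q 𝒟.symm w) (hw' : IsSpectralMeasure 𝒟.dualQ 𝒟.dualSymm w')
    (hcompact : IsCompact w.support) : w' ≪ w := by
  rw [dual_eq_withDensity hw hw' hcompact]
  exact withDensity_absolutelyContinuous _ _

/-! ### The correlation kernel as an integral of Poisson tails -/

theorem circleIntegral_integral_swap {ρ : Measure ℝ} [IsFiniteMeasure ρ] {B R : ℝ} {c : ℂ}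
    (hR : 0 ≤ R) (hρ : ρ (Set.Icc 0 B)ᶜ = 0) {g : ℂ → ℝ → ℂ}
    (hg : ContinuousOn (Function.uncurry g) (Metric.sphere c R ×ˢ Set.Icc 0 B)) :
    (∮ u in C(c, R), ∫ x, g u x ∂ρ) = ∫ x, ∮ u in C(c, R), g u x ∂ρ := by
  have hρ' : ρ.restrict (Set.Icc 0 B) = ρ := Measure.restrict_eq_self_of_ae_mem (by
    rw [ae_iff]; exact hρ)
  simp only [circleIntegral, ← integral_smul]
  simp only [intervalIntegral.integral_of_le Real.two_pi_pos.le]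
  refine integral_integral_swap ?_
  rw [← hρ', Measure.prod_restrict]
  have hcont : ContinuousOn (Function.uncurry fun (θ : ℝ) (x : ℝ) =>
      deriv (circleMap c R) θ • g (circleMap c R θ) x)
      (Set.Icc 0 (2 * Real.pi) ×ˢ Set.Icc 0 B) := by
    refine ContinuousOn.smul (f := fun q : ℝ × ℝ => deriv (circleMap c R) q.1)
      (g := fun q : ℝ × ℝ => g (circleMap c R q.1) q.2) ?_ ?_
    · simp only [deriv_circleMap]
      exact (((continuous_circleMap 0 R).comp continuous_fst).mul continuous_const).continuousOn
    · refine hg.comp (f := fun q : ℝ × ℝ => (circleMap c R q.1, q.2)) ?_ ?_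
      · exact (((continuous_circleMap c R).comp continuous_fst).prodMk
          continuous_snd).continuousOn
      · intro q hq
        exact ⟨circleMap_mem_sphere c hR q.1, hq.2⟩
  exact (hcont.integrableOn_compact (isCompact_Icc.prod isCompact_Icc)).mono_set
    (Set.prod_mono_left Set.Ioc_subset_Icc_self)

/-- The contour integral in the correlation kernel at `ψ = ψ_t`, for fixed `x` and up to a factor
`-2πi`: each monomial of `G` contributes a Poisson tail. Here `z` is the difference of the
exponents of `x` and `u`, and `K` is the exponent of `u`. -/
noncomputable def tailSum (G : Polynomial ℝ) (z : ℤ) (t : ℝ) (K : ℕ) (x : ℝ) : ℝ :=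
  ∑ k ∈ Finset.range (G.natDegree + 1),
    G.coeff k * (x ^ (z + k) * poissonTail (K - k) (t * x))

theorem measurable_tailSum (G : Polynomial ℝ) (z : ℤ) (t : ℝ) (K : ℕ) :
    Measurable (tailSum G z t K) := by
  unfold tailSum
  refine Finset.measurable_fun_sum _ fun k _ => ?_
  have : Measurable fun x => poissonTail (K - k) (t * x) :=
    (continuous_poissonTail _).measurable.comp (measurable_const_mul t)
  fun_prop

theorem circleIntegral_eq_tailSum {c : ℂ} {R x : ℝ} (h0 : (0 : ℂ) ∈ Metric.ball c R)
    (hx : (x : ℂ) ∈ Metric.ball c R) (G : Polynomial ℝ) (t : ℝ) {K L : ℕ} (hL : 0 < L)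
    (hK : G.natDegree < K) :
    (∮ u in C(c, R), Polynomial.aeval u G *
      ((x : ℂ) ^ L / u ^ K * (psi t x / (((x : ℂ) - u) * psi t u)))) =
      -(2 * Real.pi * Complex.I * (tailSum G (L - K) t K x : ℝ)) := by
  have hR : 0 < R := Metric.pos_of_mem_ball h0
  have hne : ∀ u ∈ Metric.sphere c R, u ≠ 0 := fun u hu => (ne_zero_of_mem_sphere h0 hu).symm
  have hne' : ∀ u ∈ Metric.sphere c R, (x : ℂ) - u ≠ 0 := fun u hu =>
    sub_ne_zero.2 (ne_zero_of_mem_sphere hx hu)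
  have h1 : (∮ u in C(c, R), Polynomial.aeval u G *
      ((x : ℂ) ^ L / u ^ K * (psi t x / (((x : ℂ) - u) * psi t u)))) =
      ∮ u in C(c, R), ∑ k ∈ Finset.range (G.natDegree + 1),
        ((G.coeff k : ℂ) * (x ^ L * Complex.exp (-(t * x)))) *
          (Complex.exp (t * u) / (u ^ (K - k) * (x - u))) := by
    refine circleIntegral.integral_congr hR.le fun u hu => ?_
    rw [Polynomial.aeval_eq_sum_range, Finset.sum_mul]
    refine Finset.sum_congr rfl fun k hk => ?_
    have hkK : k ≤ K := (Nat.lt_succ_iff.1 (Finset.mem_range.1 hk)).trans hK.le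
    have hu0 := hne u hu
    have hu1 := hne' u hu
    have hu2 : u ^ K = u ^ (K - k) * u ^ k := by rw [← pow_add, Nat.sub_add_cancel hkK]
    rw [hu2, psi, psi, Complex.exp_neg (t * u), Complex.real_smul]
    have := Complex.exp_ne_zero (t * u)
    field_simp
  rw [h1, circleIntegral.integral_fun_sum]
  · rw [tailSum, Complex.ofReal_sum, Finset.mul_sum, ← Finset.sum_neg_distrib]
    refine Finset.sum_congr rfl fun k hk => ?_
    have hkK : k < K := (Nat.lt_succ_iff.1 (Finset.mem_range.1 hk)).trans_lt hK
    rw [circleIntegral.integral_const_mul]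
    rcases eq_or_ne x 0 with rfl | hx0
    · -- at `x = 0` both sides vanish, as `L > 0` and the tail starts beyond `0`
      have : poissonTail (K - k) (t * 0) = 0 := by
        obtain ⟨n, hn⟩ : ∃ n, K - k = n + 1 := ⟨K - k - 1, by omega⟩
        rw [hn, poissonTail, Finset.sum_range_succ', mul_zero]
        simp
      rw [this]
      simp [hL.ne']
    · have h2 := circleIntegral_exp_div_eq_poissonTail h0 hx t (K - k)
      have hxc : (x : ℂ) ≠ 0 := by exact_mod_cast hx0
      have h3 : (x : ℂ) ^ L = (x : ℂ) ^ ((L : ℤ) - K + k) * (x : ℂ) ^ (K - k) := by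
        rw [← zpow_natCast (x : ℂ) (K - k), ← zpow_add₀ hxc, ← zpow_natCast]
        congr 1
        push_cast [Nat.cast_sub hkK.le]
        ring
      rw [h3]
      push_cast
      linear_combination ((G.coeff k : ℂ) * (x : ℂ) ^ ((L : ℤ) - K + k)) * h2
  · intro k _
    refine ContinuousOn.circleIntegrable hR.le (ContinuousOn.mul continuousOn_const
      (ContinuousOn.div (by fun_prop) (by fun_prop) fun u hu =>
        mul_ne_zero (pow_ne_zero _ (hne u hu)) (hne' u hu)))

/-- The double integral in the correlation kernel at `ψ = ψ_t`, for non-negative exponents. -/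
theorem circleIntegral_integral_eq {ρ : Measure ℝ} [IsFiniteMeasure ρ] {B R : ℝ} {c : ℂ}
    (hB : 0 ≤ B) (hC : ∀ x ∈ Set.Icc 0 B, (x : ℂ) ∈ Metric.ball c R)
    (hρ : ρ (Set.Icc 0 B)ᶜ = 0) (F G : Polynomial ℝ) (t : ℝ) {K L : ℕ} (hL : 0 < L)
    (hK : G.natDegree < K) :
    1 / (2 * Real.pi * Complex.I) * (∮ u in C(c, R), Polynomial.aeval u G *
      ∫ x : ℝ, ((F.eval x : ℝ) : ℂ) *
        ((x : ℂ) ^ L / u ^ K * (psi t x / (((x : ℂ) - u) * psi t u))) ∂ρ) =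
      ((-∫ x, F.eval x * tailSum G (L - K) t K x ∂ρ : ℝ) : ℂ) := by
  have h0 : (0 : ℂ) ∈ Metric.ball c R := by simpa using hC 0 ⟨le_rfl, hB⟩
  have hR : 0 < R := Metric.pos_of_mem_ball h0
  simp only [← integral_const_mul]
  rw [circleIntegral_integral_swap hR.le hρ]
  · have hρ' : ∀ᵐ x ∂ρ, x ∈ Set.Icc 0 B := by rw [ae_iff]; exact hρ
    rw [← integral_neg, ← integral_complex_ofReal, ← integral_const_mul]
    refine integral_congr_ae ?_
    filter_upwards [hρ'] with x hx
    have h1 : ∀ u : ℂ, Polynomial.aeval u G * (((F.eval x : ℝ) : ℂ) *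
        ((x : ℂ) ^ L / u ^ K * (psi t x / (((x : ℂ) - u) * psi t u)))) =
        ((F.eval x : ℝ) : ℂ) * (Polynomial.aeval u G *
        ((x : ℂ) ^ L / u ^ K * (psi t x / (((x : ℂ) - u) * psi t u)))) := fun u => by ring
    simp only [h1]
    rw [circleIntegral.integral_const_mul, circleIntegral_eq_tailSum h0 (hC x hx) G t hL hK]
    have := Complex.two_pi_I_ne_zero
    push_cast
    field_simp
  · have hne : ∀ q ∈ Metric.sphere c R ×ˢ Set.Icc 0 B, q.1 ≠ 0 := fun q hq =>
      (ne_zero_of_mem_sphere h0 hq.1).symm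
    have hne' : ∀ q ∈ Metric.sphere c R ×ˢ Set.Icc 0 B, (q.2 : ℂ) - q.1 ≠ 0 := fun q hq =>
      sub_ne_zero.2 (ne_zero_of_mem_sphere (hC _ hq.2) hq.1)
    have hF : Continuous fun q : ℂ × ℝ => ((F.eval q.2 : ℝ) : ℂ) :=
      Complex.continuous_ofReal.comp (F.continuous.comp continuous_snd)
    have hG : Continuous fun q : ℂ × ℝ => Polynomial.aeval q.1 G :=
      (Polynomial.continuous_aeval G).comp continuous_fst
    simp only [psi]
    refine hG.continuousOn.mul (hF.continuousOn.mul (ContinuousOn.mul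
      (ContinuousOn.div (by fun_prop) (by fun_prop) fun q hq => pow_ne_zero _ (hne q hq))
      (ContinuousOn.div (by fun_prop) (by fun_prop) fun q hq =>
        mul_ne_zero (hne' q hq) (Complex.exp_ne_zero _))))

/-! ### The limit of the kernel -/

theorem eventually_floor_add_ge {η : ℝ} (hη : 0 < η) (b k : ℤ) :
    ∀ᶠ N : ℕ in atTop, k ≤ ⌊(N : ℝ) * η⌋ + b := by
  have h : Tendsto (fun N : ℕ => (N : ℝ) * η) atTop atTop :=
    tendsto_natCast_atTop_atTop.atTop_mul_const hη
  filter_upwards [h.eventually_ge_atTop ((k - b : ℤ) : ℝ)] with N hN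
  have := Int.le_floor.2 hN
  omega

theorem tendsto_floor_add_div {η : ℝ} (hη : 0 < η) (b : ℤ) (k : ℕ) :
    Tendsto (fun N : ℕ => (((⌊(N : ℝ) * η⌋ + b).toNat - k : ℕ) : ℝ) / N) atTop (𝓝 η) := by
  have h1 : Tendsto (fun N : ℕ => (⌊η * (N : ℝ)⌋₊ : ℝ) / N) atTop (𝓝 η) :=
    (tendsto_nat_floor_mul_div_atTop hη.le).comp tendsto_natCast_atTop_atTop
  have h2 : Tendsto (fun N : ℕ => ((b : ℝ) - k) / N) atTop (𝓝 0) :=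
    tendsto_const_nhds.div_atTop tendsto_natCast_atTop_atTop
  have h3 := h1.add h2
  rw [add_zero] at h3
  refine h3.congr' ?_
  filter_upwards [eventually_floor_add_ge hη b k] with N hN
  have h4 : (0 : ℤ) ≤ ⌊(N : ℝ) * η⌋ + b := (Int.natCast_nonneg k).trans hN
  have h5 : k ≤ (⌊(N : ℝ) * η⌋ + b).toNat := by omega
  have h6 : (((⌊(N : ℝ) * η⌋ + b).toNat : ℕ) : ℝ) = ((⌊(N : ℝ) * η⌋ + b : ℤ) : ℝ) := by
    exact_mod_cast congrArg (Int.cast : ℤ → ℝ) (Int.toNat_of_nonneg h4)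
  have h7 : ((⌊η * (N : ℝ)⌋₊ : ℕ) : ℝ) = ((⌊(N : ℝ) * η⌋ : ℤ) : ℝ) := by
    rw [mul_comm, natCast_floor_eq_intCast_floor (by positivity)]
  rw [← add_div, Nat.cast_sub h5, h6, h7]
  push_cast
  ring

open Classical in
theorem tendsto_tailSum {τ η : ℝ} (hτ : 0 < τ) (hη : 0 < η) (G : Polynomial ℝ) (z b : ℤ) {x : ℝ}
    (hx : 0 ≤ x) (hxα : x ≠ η / τ) :
    Tendsto (fun N : ℕ => tailSum G z (N * τ) (⌊(N : ℝ) * η⌋ + b).toNat x) atTop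
      (𝓝 ((if η / τ ≤ x then 1 else 0) * (x ^ z * G.eval x))) := by
  have hα : 0 < η / τ := by positivity
  have h1 : ∀ k : ℕ, Tendsto (fun N : ℕ =>
      poissonTail ((⌊(N : ℝ) * η⌋ + b).toNat - k) (N * τ * x)) atTop
      (𝓝 (if η / τ ≤ x then 1 else 0)) := by
    intro k
    simp only [mul_assoc]
    split_ifs with h
    · refine tendsto_poissonTail_one (tendsto_floor_add_div hη b k) hη ?_
      have := (div_lt_iff₀ hτ).1 (lt_of_le_of_ne h hxα.symm)
      linarith
    · refine tendsto_poissonTail_zero (tendsto_floor_add_div hη b k) (by positivity) ?_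
      have := (lt_div_iff₀ hτ).1 (not_le.1 h)
      linarith
  have h2 : (if η / τ ≤ x then (1 : ℝ) else 0) * (x ^ z * G.eval x) =
      ∑ k ∈ Finset.range (G.natDegree + 1),
        G.coeff k * (x ^ (z + k) * if η / τ ≤ x then 1 else 0) := by
    split_ifs with h
    · have hx0 : x ≠ 0 := (hα.trans_le h).ne'
      rw [one_mul, Polynomial.eval_eq_sum_range, Finset.mul_sum]
      refine Finset.sum_congr rfl fun k _ => ?_
      rw [zpow_add₀ hx0, zpow_natCast]
      ring
    · simp
  rw [h2]
  exact tendsto_finsetSum _ fun k _ => ((h1 k).const_mul _).const_mul _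

theorem exists_bound_tailSum {τ η : ℝ} (hτ : 0 < τ) (hη : 0 < η) (G : Polynomial ℝ) (z b : ℤ)
    (B : ℝ) : ∃ D : ℝ, ∀ᶠ N : ℕ in atTop, ∀ x ∈ Set.Icc 0 B,
      |tailSum G z (N * τ) (⌊(N : ℝ) * η⌋ + b).toNat x| ≤ D := by
  -- `p` grows like `N η`, so that `2 τ / η` exceeds the limit `τ / η` of the ratio `N τ / p`
  have hterm : ∀ k : ℕ, ∀ᶠ N : ℕ in atTop, ∀ x ∈ Set.Icc 0 B,
      x ^ (z + k) * poissonTail ((⌊(N : ℝ) * η⌋ + b).toNat - k) (N * τ * x) ≤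
        max B 1 ^ (z + k).natAbs + max (2 * τ / η) 1 ^ (z + k).natAbs := by
    intro k
    have h1 := (tendsto_floor_add_div hη b (k + (z + k).natAbs)).eventually_const_le
      (half_lt_self hη)
    filter_upwards [h1, eventually_gt_atTop 0,
      eventually_floor_add_ge hη b (k + (z + k).natAbs + 1)] with N hN hN0 hN1 x hx
    have hN0' : (0 : ℝ) < N := by exact_mod_cast hN0
    refine zpow_mul_poissonTail_le (by positivity) hx.1 hx.2 (by omega) ?_
    rw [le_div_iff₀ hN0'] at hN
    rw [Nat.sub_sub, div_mul_eq_mul_div, le_div_iff₀ hη]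
    nlinarith
  refine ⟨∑ k ∈ Finset.range (G.natDegree + 1), |G.coeff k| *
    (max B 1 ^ (z + k).natAbs + max (2 * τ / η) 1 ^ (z + k).natAbs), ?_⟩
  have hall := (Finset.eventually_all (Finset.range (G.natDegree + 1))).2 fun k _ => hterm k
  filter_upwards [hall] with N hN x hx
  refine (Finset.abs_sum_le_sum_abs _ _).trans (Finset.sum_le_sum fun k hk => ?_)
  have h0 : 0 ≤ x ^ (z + k) * poissonTail ((⌊(N : ℝ) * η⌋ + b).toNat - k) (N * τ * x) :=
    mul_nonneg (zpow_nonneg hx.1 _) (poissonTail_nonneg _ (by have := hx.1; positivity))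
  rw [abs_mul, abs_of_nonneg h0]
  exact mul_le_mul_of_nonneg_left (hN k hk x hx) (abs_nonneg _)

open Classical in
/-- Dominated convergence for the integrals of Poisson tails. -/
theorem tendsto_integral_tailSum {ρ : Measure ℝ} [IsFiniteMeasure ρ] {B τ η : ℝ}
    (hρ : ρ (Set.Icc 0 B)ᶜ = 0) (hτ : 0 < τ) (hη : 0 < η) (hα : ρ {η / τ} = 0)
    (hmom : ∀ k : ℕ, Integrable (fun x : ℝ => x ^ k) ρ) (F G : Polynomial ℝ) (z b : ℤ) :
    Tendsto (fun N : ℕ => ∫ x, F.eval x *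
        tailSum G z (N * τ) (⌊(N : ℝ) * η⌋ + b).toNat x ∂ρ) atTop
      (𝓝 (∫ x, F.eval x * ((if η / τ ≤ x then 1 else 0) * (x ^ z * G.eval x)) ∂ρ)) := by
  obtain ⟨D, hD⟩ := exists_bound_tailSum hτ hη G z b B
  have hρ' : ∀ᵐ x ∂ρ, x ∈ Set.Icc 0 B := by rw [ae_iff]; exact hρ
  have hα' : ∀ᵐ x ∂ρ, x ≠ η / τ := by
    rw [ae_iff]; simpa using hα
  refine tendsto_integral_filter_of_dominated_convergence (fun x => |F.eval x| * D)
    (Eventually.of_forall fun N =>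
      (F.continuous.measurable.mul (measurable_tailSum _ _ _ _)).aestronglyMeasurable) ?_
    ((integrable_polynomial hmom F).abs.mul_const D) ?_
  · filter_upwards [hD] with N hN
    filter_upwards [hρ'] with x hx
    rw [norm_mul, Real.norm_eq_abs, Real.norm_eq_abs]
    exact mul_le_mul_of_nonneg_left (hN x hx) (abs_nonneg _)
  · filter_upwards [hρ', hα'] with x hx hxα
    exact (tendsto_tailSum hτ hη G z b hx.1 hxα).const_mul _

namespace Level

theorem fst_shift (k : ℤ) (n : Level) : (n.shift k).fst = k + n.fst := by
  cases n <;> rfl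

theorem snd_shift (k : ℤ) (n : Level) : (n.shift k).snd = k + n.snd := by
  cases n <;> simp [shift, snd, add_assoc]

theorem shift_le_shift (k : ℤ) (m n : Level) : m.shift k ≤ n.shift k ↔ m ≤ n := by
  change (m.shift k).fst ≤ (n.shift k).fst ∧ (m.shift k).snd ≤ (n.shift k).snd ↔
    m.fst ≤ n.fst ∧ m.snd ≤ n.snd
  simp [fst_shift, snd_shift]

end Level

theorem barP_shift (𝒟 : Rates) (k : ℤ) (n : Level) : barP 𝒟 (n.shift k) = barP 𝒟 n := by
  cases n <;> rfl

theorem tildeP_shift (𝒟 : Rates) (k : ℤ) (n : Level) : tildeP 𝒟 (n.shift k) = tildeP 𝒟 n := by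
  cases n <;> rfl

theorem levelMeasure_shift (w w' : Measure ℝ) (k : ℤ) (n : Level) :
    levelMeasure w w' (n.shift k) = levelMeasure w w' n := by
  cases n <;> rfl

/-- Away from `0` the exponent of `x` may be negative. -/
theorem integrable_indicator_mul_zpow {ρ : Measure ℝ} [IsFiniteMeasure ρ] {B α : ℝ} (hα : 0 < α)
    (hρ : ρ (Set.Icc 0 B)ᶜ = 0) (F G : Polynomial ℝ) (z : ℤ) :
    Integrable ((Set.Ici α).indicator fun x => F.eval x * (x ^ z * G.eval x)) ρ := by
  rw [integrable_indicator_iff measurableSet_Ici]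
  have hρ' : ∀ᵐ x ∂ρ, x ∈ Set.Icc 0 B := by rw [ae_iff]; exact hρ
  have hset : Set.Icc α B =ᵐ[ρ] Set.Ici α := by
    filter_upwards [hρ'] with x hx
    exact propext ⟨fun h => h.1, fun h => ⟨h, hx.2⟩⟩
  refine IntegrableOn.congr_set_ae ?_ hset.symm
  refine ContinuousOn.integrableOn_compact isCompact_Icc ?_
  exact F.continuous.continuousOn.mul (ContinuousOn.mul
    (continuousOn_id.zpow₀ z fun x hx => Or.inl (hα.trans_le hx.1).ne') G.continuous.continuousOn)

theorem integrable_mul_zpow {ρ : Measure ℝ} (hmom : ∀ k : ℕ, Integrable (fun x : ℝ => x ^ k) ρ)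
    (F G : Polynomial ℝ) {z : ℤ} (hz : 0 ≤ z) :
    Integrable (fun x => F.eval x * (x ^ z * G.eval x)) ρ := by
  obtain ⟨n, rfl⟩ := Int.eq_ofNat_of_zero_le hz
  exact (integrable_polynomial hmom (F * (Polynomial.X ^ n * G))).congr
    (ae_of_all _ fun x => by simp)

open Classical in
theorem limitIntegrand_eq (𝒟 : Rates) (α : ℝ) (n : Level) (i : ℕ) (m : Level) (j : ℕ) :
    limitIntegrand 𝒟 α n i m j = fun x =>
      -((Set.Ici α).indicator (fun x => (barP 𝒟 n i).eval x *
        (x ^ (n.snd - m.snd) * (tildeP 𝒟 m j).eval x)) x) +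
      if m ≤ n then (barP 𝒟 n i).eval x * (x ^ (n.snd - m.snd) * (tildeP 𝒟 m j).eval x)
      else 0 := by
  funext x
  simp only [limitIntegrand, Set.indicator_apply, Set.mem_Ici]
  split_ifs <;> ring

/-- The dual measure inherits the support and the null sets of `w`, so that both kinds of levels can
be treated alike. -/
theorem levelMeasure_properties {𝒟 : Rates} {w w' : Measure ℝ}
    (hw : IsSpectralMeasure 𝒟.Q 𝒟.symm w) (hw' : IsSpectralMeasure 𝒟.dualQ 𝒟.dualSymm w')
    (hcompact : IsCompact w.support) (n : Level) :
    IsFiniteMeasure (levelMeasure w w' n) ∧ levelMeasure w w' n ≪ w ∧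
      (∀ k : ℕ, Integrable (fun x : ℝ => x ^ k) (levelMeasure w w' n)) ∧
      (levelMeasure w w' n) (Set.Icc 0 (upperEnd w))ᶜ = 0 ∧
      (levelMeasure w w' n).restrict (Set.Icc (lowerEnd w) (upperEnd w)) =
        levelMeasure w w' n := by
  have hac : levelMeasure w w' n ≪ w := by
    cases n
    · exact Measure.AbsolutelyContinuous.rfl
    · exact dual_absolutelyContinuous hw hw' hcompact
  have h0 := hac (measure_compl_Icc_support hcompact)
  refine ⟨?_, hac, ?_, ?_, ?_⟩
  · cases n
    · exact hw.isFiniteMeasure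
    · exact hw'.isFiniteMeasure
  · cases n
    · exact hw.moments
    · exact hw'.moments
  · exact measure_mono_null (Set.compl_subset_compl.2
      (Set.Icc_subset_Icc_left (lowerEnd_nonneg hw))) h0
  · exact Measure.restrict_eq_self_of_ae_mem (by rw [ae_iff]; exact h0)

theorem integrable_limitIntegrand {𝒟 : Rates} {ρ : Measure ℝ} [IsFiniteMeasure ρ] {B α : ℝ}
    (hα : 0 < α) (hρ : ρ (Set.Icc 0 B)ᶜ = 0)
    (hmom : ∀ k : ℕ, Integrable (fun x : ℝ => x ^ k) ρ) (n : Level) (i : ℕ) (m : Level) (j : ℕ) :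
    Integrable (limitIntegrand 𝒟 α n i m j) ρ := by
  rw [limitIntegrand_eq]
  refine (integrable_indicator_mul_zpow hα hρ _ _ _).neg.add ?_
  split_ifs with h
  · exact integrable_mul_zpow hmom _ _ (sub_nonneg.2 h.2)
  · exact integrable_zero _ _ _

theorem tendsto_corrKernel {𝒟 : Rates} {w w' : Measure ℝ}
    (hw : IsSpectralMeasure 𝒟.Q 𝒟.symm w) (hw' : IsSpectralMeasure 𝒟.dualQ 𝒟.dualSymm w')
    (hcompact : IsCompact w.support) {τ η : ℝ} (hτ : 0 < τ) (hη : 0 < η) (hα : w {η / τ} = 0)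
    {c : ℂ} {R : ℝ} (hC : ∀ x ∈ Set.Icc 0 (upperEnd w), (x : ℂ) ∈ Metric.ball c R)
    (n m : Level) (i j : ℕ) :
    Tendsto (fun N : ℕ => corrKernel 𝒟 w w' c R (psi (N * τ))
      (n.shift ⌊(N : ℝ) * η⌋) i (m.shift ⌊(N : ℝ) * η⌋) j) atTop
      (𝓝 ((limitKernel 𝒟 w w' (η / τ) n i m j : ℝ) : ℂ)) := by
  classical
  obtain ⟨hfin, hac, hmom, hρ, hres⟩ := levelMeasure_properties hw hw' hcompact n
  have hα0 : 0 < η / τ := by positivity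
  set ρ := levelMeasure w w' n with hρdef
  set F := barP 𝒟 n i with hF
  set G := tildeP 𝒟 m j with hG
  have hlim := tendsto_integral_tailSum hρ hτ hη (hac hα) hmom F G (n.snd - m.snd) m.snd
  set S : ℝ := if m ≤ n then ∫ x, F.eval x * (x ^ (n.snd - m.snd) * G.eval x) ∂ρ else 0 with hS
  have hval : limitKernel 𝒟 w w' (η / τ) n i m j = -(∫ x, F.eval x *
      ((if η / τ ≤ x then 1 else 0) * (x ^ (n.snd - m.snd) * G.eval x)) ∂ρ) + S := by
    rw [limitKernel, ← hρdef, hres, limitIntegrand_eq, ← hF, ← hG]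
    have h1 := integrable_indicator_mul_zpow hα0 hρ F G (n.snd - m.snd)
    have h2 : (fun x => F.eval x *
        ((if η / τ ≤ x then 1 else 0) * (x ^ (n.snd - m.snd) * G.eval x))) =
        (Set.Ici (η / τ)).indicator fun x => F.eval x * (x ^ (n.snd - m.snd) * G.eval x) := by
      funext x
      simp only [Set.indicator_apply, Set.mem_Ici]
      split_ifs <;> ring
    rw [h2, hS]
    split_ifs with h
    · have h3 := integrable_mul_zpow hmom F G (sub_nonneg.2 h.2 : 0 ≤ n.snd - m.snd)
      exact (integral_add h1.neg h3).trans (congrArg (· + _) (integral_neg _))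
    · simp only [add_zero]
      rw [integral_neg]
  rw [hval]
  refine ((Complex.continuous_ofReal.tendsto _).comp (hlim.neg.add_const S)).congr' ?_
  filter_upwards [eventually_floor_add_ge hη n.snd 1,
    eventually_floor_add_ge hη m.snd (G.natDegree + 1)] with N hN1 hN2
  obtain ⟨L, hL⟩ := Int.eq_ofNat_of_zero_le (by omega : 0 ≤ ⌊(N : ℝ) * η⌋ + n.snd)
  obtain ⟨K, hK⟩ := Int.eq_ofNat_of_zero_le (by omega : 0 ≤ ⌊(N : ℝ) * η⌋ + m.snd)
  have hz : (L : ℤ) - K = n.snd - m.snd := by omega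
  have hkey := circleIntegral_integral_eq (upperEnd_nonneg hw hcompact) hC hρ F G (N * τ)
    (L := L) (K := K) (by omega) (by omega)
  rw [corrKernel, barP_shift, tildeP_shift, levelMeasure_shift, Level.snd_shift,
    Level.snd_shift, hL, hK, ← hF, ← hG, ← hρdef]
  simp only [zpow_natCast, Level.shift_le_shift, hz]
  rw [hkey, hz, Function.comp_apply, hK, Int.toNat_natCast, hS, Complex.ofReal_add]
  congr 1
  split_ifs <;> simp

/-- The conjugation relating a kernel at a single level to the hole kernel is by the signed square
roots of the symmetrizing measure. -/
theorem isHoleKernel_of_isSpectralMeasure {b d : ℕ → ℝ} (hb : ∀ n, 0 < b n)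
    {p : ℕ → ℝ} (hp : ∀ n, 0 < p n) {W : Measure ℝ}
    (hW : IsSpectralMeasure (chainPoly b d) p W) {P : ℕ → Polynomial ℝ}
    (hP : IsOrthonormalPolys W P) (α : ℝ) {k : ℕ → ℕ → ℝ}
    (hk : ∀ i j, k i j = p i * (∫ x, (chainPoly b d i).eval x * (chainPoly b d j).eval x ∂W -
      ∫ x in Set.Ici α, (chainPoly b d i).eval x * (chainPoly b d j).eval x ∂W)) :
    IsHoleKernel k (ensembleKernel W P α) := by
  have hsq : ∀ i, √(p i) ≠ 0 := fun i => (Real.sqrt_pos.2 (hp i)).ne'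
  refine isHoleKernel_of_conj (c := fun i => (-1) ^ i * √(p i)) (fun i => by simp [hsq i])
    fun i j => ?_
  have hP' := (isOrthonormalPolys_of_isSpectralMeasure hb hp hW).unique hW.moments hP
  have hK : ensembleKernel W P α i j = (-1) ^ i * √(p i) * ((-1) ^ j * √(p j)) *
      ∫ x in Set.Ici α, (chainPoly b d i).eval x * (chainPoly b d j).eval x ∂W := by
    rw [ensembleKernel, ← integral_const_mul, hP' i, hP' j]
    congr 1
    funext x
    simp only [Polynomial.eval_mul, Polynomial.eval_C]
    ring
  have hi := Real.mul_self_sqrt (hp i).le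
  have h2 : ∀ i, ((-1 : ℝ) ^ i) * (-1) ^ i = 1 := fun i => by rw [← mul_pow]; simp
  have hj1 : (-1 : ℝ) ^ j * √(p j) ≠ 0 := by simp [hsq j]
  rw [hk, hK, hW.orthogonal, eq_div_iff hj1]
  generalize (∫ x in Set.Ici α, (chainPoly b d i).eval x * (chainPoly b d j).eval x ∂W) = T
  have h3 := h2 i
  split_ifs with hij
  · subst hij
    have := (hp i).ne'
    rw [mul_sub, mul_one_div_cancel this]
    linear_combination (-1) ^ i * √(p i) * T * (p i * h3 + (-1) ^ i * (-1) ^ i * hi)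
  · linear_combination (-1) ^ j * √(p j) * T * (p i * h3 + (-1) ^ i * (-1) ^ i * hi)

theorem limitKernel_self {𝒟 : Rates} {w w' : Measure ℝ}
    (hw : IsSpectralMeasure 𝒟.Q 𝒟.symm w) (hw' : IsSpectralMeasure 𝒟.dualQ 𝒟.dualSymm w')
    (hcompact : IsCompact w.support) {α a : ℝ} (n : Level) {q : Polynomial ℝ} {i : ℕ}
    (hq : barP 𝒟 n i = Polynomial.C a * q) (j : ℕ) :
    limitKernel 𝒟 w w' α n i n j =
      a * (∫ x, q.eval x * (tildeP 𝒟 n j).eval x ∂(levelMeasure w w' n) -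
        ∫ x in Set.Ici α, q.eval x * (tildeP 𝒟 n j).eval x ∂(levelMeasure w w' n)) := by
  classical
  obtain ⟨hfin, -, hmom, -, hres⟩ := levelMeasure_properties hw hw' hcompact n
  have hint : Integrable (fun x => q.eval x * (tildeP 𝒟 n j).eval x) (levelMeasure w w' n) := by
    simpa using integrable_polynomial hmom (q * tildeP 𝒟 n j)
  rw [limitKernel, hres, ← integral_indicator measurableSet_Ici,
    ← integral_sub hint (hint.indicator measurableSet_Ici), ← integral_const_mul]
  congr 1
  funext x
  have hn : n ≤ n := ⟨le_rfl, le_rfl⟩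
  simp only [limitIntegrand, hq, if_pos hn, sub_self, zpow_zero, Set.indicator_apply,
    Set.mem_Ici, Polynomial.eval_mul, Polynomial.eval_C]
  split_ifs <;> ring

end AlternatingKernel

open AlternatingKernel
theorem mainTheorem12 (𝒟 : Rates) (w w' : Measure ℝ)
    (hw : IsSpectralMeasure 𝒟.Q 𝒟.symm w)
    (hw' : IsSpectralMeasure 𝒟.dualQ 𝒟.dualSymm w')
    (hcompact : IsCompact w.support)
    (τ η : ℝ) (hτ : 0 < τ) (hη : 0 < η) (hα : w {η / τ} = 0)
    (c : ℂ) (R : ℝ)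
    (hC : ∀ x ∈ Set.Icc 0 (upperEnd w), (x : ℂ) ∈ Metric.ball c R) :
    (∀ (n m : Level) (i j : ℕ),
      IntegrableOn (limitIntegrand 𝒟 (η / τ) n i m j)
        (Set.Icc (lowerEnd w) (upperEnd w)) (levelMeasure w w' n) ∧
      Tendsto
        (fun N : ℕ => corrKernel 𝒟 w w' c R (psi (N * τ))
          (n.shift ⌊(N : ℝ) * η⌋) i (m.shift ⌊(N : ℝ) * η⌋) j)
        atTop (𝓝 ((limitKernel 𝒟 w w' (η / τ) n i m j : ℝ) : ℂ))) ∧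
    ((∃ P, IsOrthonormalPolys w P) ∧ ∀ P, IsOrthonormalPolys w P → ∀ n : ℤ,
      IsHoleKernel (fun i j => limitKernel 𝒟 w w' (η / τ) (.odd n) i (.odd n) j)
        (ensembleKernel w P (η / τ))) ∧
    ((∃ P, IsOrthonormalPolys w' P) ∧ ∀ P, IsOrthonormalPolys w' P → ∀ n : ℤ,
      IsHoleKernel (fun i j => limitKernel 𝒟 w w' (η / τ) (.even n) i (.even n) j)
        (ensembleKernel w' P (η / τ))) := by
  have hα0 : 0 < η / τ := div_pos hη hτ
  refine ⟨fun n m i j => ⟨?_, tendsto_corrKernel hw hw' hcompact hτ hη hα hC n m i j⟩,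
    ⟨⟨_, isOrthonormalPolys_of_isSpectralMeasure 𝒟.birth_pos 𝒟.symm_pos hw⟩, fun P hP n => ?_⟩,
    ⟨⟨_, isOrthonormalPolys_of_isSpectralMeasure 𝒟.death_pos 𝒟.dualSymm_pos hw'⟩,
      fun P hP n => ?_⟩⟩
  · obtain ⟨_, -, hmom, hρ, hres⟩ := levelMeasure_properties hw hw' hcompact n
    rw [IntegrableOn, hres]
    exact integrable_limitIntegrand hα0 hρ hmom n i m j
  · exact isHoleKernel_of_isSpectralMeasure 𝒟.birth_pos 𝒟.symm_pos hw hP _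
      fun i j => limitKernel_self hw hw' hcompact (.odd n) rfl j
  · exact isHoleKernel_of_isSpectralMeasure 𝒟.death_pos 𝒟.dualSymm_pos hw' hP _
      fun i j => limitKernel_self hw hw' hcompact (.even n) rfl j
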